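/- Let $\mathbb G=(\mathbb R^N,\circ,\delta_\lambda)$ be a homogeneous Carnot group: $\mathbb R^N=\mathbb R^{N_1}\times\dots\times\mathbb R^{N_r}$ with a Lie group law $\circ$ such that the dilations $\delta_\lambda(x^{(1)},\dots,x^{(r)})=(\lambda x^{(1)},\dots,\lambda^r x^{(r)})$, $\lambda>0$, are automorphisms, and the iterated commutators of the left-invariant vector fields $X_1,\dots,X_{N_1}$ with $X_k(0)=\partial/\partial x_k$ span $\mathbb R^N$ at every point. Assume that the homogeneous dimension $Q=\sum_k kN_k$ is at least $3$, and let $\mathcal L=\sum_{k=1}^{N_1}X_k^2$. Let $\Omega\subset\mathbb G$ be a bounded connected open set whose boundary is piecewise smooth and simple, in the following sense: $\partial\Omega$ has finite $(N-1)$-dimensional area, and off a set of zero area every point of $\partial\Omega$ has an open neighbourhood $U$ with $\Omega\cap U=\{\varphi<0\}$ and $\partial\Omega\cap U=\{\varphi=0\}$ for some $\varphi\in C^1(U)$ with nowhere vanishing gradient. Let $dS$ be the surface measure on $\partial\Omega$, $v$ the Euclidean outer unit normal, and let $\langle X_j,d\nu\rangle$ be the boundary form obtained by contracting the volume form $d\nu=dx_1\wedge\dots\wedge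 dx_N$ with $X_j$, that is, $\langle X_j,d\nu\rangle=(X_j\cdot v)\,dS$ on $\partial\Omega$. Let $a_1,\dots,a_{N_1}:\partial\Omega\to\mathbb R$ be bounded functions such that $$\sum_{j=1}^{N_1}a_j\langle X_j,d\nu\rangle\ge 0\quad\text{on }\partial\Omega .$$ Below, solutions are real- or complex-valued functions in $C^2(\Omega)\cap C^1(\overline\Omega)$, where $u\in C^1(\overline\Omega)$ means that $u$ and its first derivatives extend continuously to $\overline\Omega$, and identities between boundary measures hold $dS$-almost everywhere. 1. The Robin problem $$\mathcal Lu=0\ \text{ in }\Omega,\qquad \sum_{j=1}^{N_1}(a_ju+X_ju)\langle X_j,d\nu\rangle=0\ \text{ on }\partial\Omega$$ has a constant solution, and each of its solutions is constant on $\overline\Omega$. 2. If moreover $\int_{\partial\Omega}\sum_{j=1}^{N_1}a_j\langle X_j,d\nu\rangle>0$, then $u\equiv0$ is the unique solution of the Robin problem. 3. If $\partial\Omega_1\subset\partial\Omega$ is any nonempty subset and $\partial\Omega_2=\partial\Omega\setminus\partial\Omega_1$, then $u\equiv0$ is the unique solution of the mixed problem $$\mathcal Lu=0\ \text{ in }\Omega,\qquad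 u=0\ \text{ on }\partial\Omega_1,\qquad \sum_{j=1}^{N_1}(a_ju+X_ju)\langle X_j,d\nu\rangle=0\ \text{ on }\partial\Omega_2 .$$ -/

import Mathlib

open Set Filter Topology MeasureTheory
open scoped Manifold ContDiff RealInnerProductSpace

noncomputable section

/-! ### Homogeneous Carnot groups -/

/-- The space `ℝ^N = ℝ^{n 0} × ⋯ × ℝ^{n (r-1)}`, with its Euclidean structure. The coordinate
`x ⟨k, m⟩` is the `m`-th coordinate in the layer `k`; layers are counted from `0`, so that the layer
`k` has weight `k + 1` and the first layer is the layer `0`. -/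
abbrev GradedSpace {r : ℕ} (n : Fin r → ℕ) : Type :=
  EuclideanSpace ℝ (Σ k : Fin r, Fin (n k))

/-- The dilation `δ_t (x⁽¹⁾, …, x⁽ʳ⁾) = (t x⁽¹⁾, …, tʳ x⁽ʳ⁾)`. -/
def dilation {r : ℕ} (n : Fin r → ℕ) (t : ℝ) (x : GradedSpace n) : GradedSpace n :=
  WithLp.toLp 2 fun i => t ^ (i.1.val + 1) * x i

/-- The homogeneous dimension `Q = ∑ k N_k`. -/
def homogeneousDimension {r : ℕ} (n : Fin r → ℕ) : ℕ :=
  ∑ k : Fin r, (k.val + 1) * n k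

/-- The Jacobian generator `X_j` for a group law on `ℝ^N`: the left-invariant vector field whose
value at the identity is the `j`-th coordinate vector of the first layer. -/
def jacobianField {r : ℕ} [NeZero r] (n : Fin r → ℕ) [Group (GradedSpace n)] (j : Fin (n 0))
    (x : GradedSpace n) : GradedSpace n :=
  fderiv ℝ (fun y : GradedSpace n => x * y) 1 (EuclideanSpace.single ⟨0, j⟩ 1)

/-- The iterated commutators of a family of vector fields on a normed space. -/
inductive IsIteratedCommutator {ι E : Type*} [NormedAddCommGroup E] [NormedSpace ℝ E]
    (X : ι → E → E) : (E → E) → Prop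
  | generator (j : ι) : IsIteratedCommutator X (X j)
  | bracket {V W : E → E} (hV : IsIteratedCommutator X V) (hW : IsIteratedCommutator X W) :
      IsIteratedCommutator X (VectorField.lieBracket ℝ V W)

/-- The group law on `ℝ^N = ℝ^{n 0} × ⋯ × ℝ^{n (r-1)}` makes it a homogeneous Carnot group: it is
a Lie group, the dilations are automorphisms, and the Jacobian generators satisfy the rank
condition (their iterated commutators span the tangent space at every point). -/
class HomogeneousCarnotGroup {r : ℕ} [NeZero r] (n : Fin r → ℕ) [Group (GradedSpace n)] : Prop
    extends LieGroup 𝓘(ℝ, GradedSpace n) ∞ (GradedSpace n) where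
  dilation_mul : ∀ t : ℝ, 0 < t → ∀ x y : GradedSpace n,
    dilation n t (x * y) = dilation n t x * dilation n t y
  rank_condition : ∀ x : GradedSpace n,
    Submodule.span ℝ {v | ∃ V, IsIteratedCommutator (jacobianField n) V ∧ V x = v} = ⊤

/-- The derivative `X f` of a function along a vector field. -/
def derivAlong {E F : Type*} [NormedAddCommGroup E] [NormedSpace ℝ E] [NormedAddCommGroup F]
    [NormedSpace ℝ F] (X : E → E) (f : E → F) (x : E) : F :=
  fderiv ℝ f x (X x)

/-- The sub-Laplacian `ℒ u = ∑ₖ Xₖ (Xₖ u)`, summed over the Jacobian generators. -/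
def subLaplacian {r : ℕ} [NeZero r] (n : Fin r → ℕ) [Group (GradedSpace n)] {F : Type*}
    [NormedAddCommGroup F] [NormedSpace ℝ F] (u : GradedSpace n → F) (x : GradedSpace n) : F :=
  ∑ k : Fin (n 0), derivAlong (jacobianField n k) (derivAlong (jacobianField n k) u) x

/-! ### Admissible domains, surface measure and outer normal -/

section Domains

variable {ι : Type*} [Fintype ι]

/-- On the open neighbourhood `U` of the boundary point `x`, the set `Ω` is `{φ < 0}` and its
boundary is `{φ = 0}`, where `φ` is `C¹` on `U` with nowhere vanishing gradient. Thus near `x` the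
boundary is a `C¹` hypersurface with `Ω` on exactly one side of it. -/
structure IsLocalDefiningFunction (Ω : Set (EuclideanSpace ℝ ι)) (x : EuclideanSpace ℝ ι)
    (U : Set (EuclideanSpace ℝ ι)) (φ : EuclideanSpace ℝ ι → ℝ) : Prop where
  mem_frontier : x ∈ frontier Ω
  isOpen : IsOpen U
  mem : x ∈ U
  contDiffOn : ContDiffOn ℝ 1 φ U
  gradient_ne_zero : ∀ y ∈ U, gradient φ y ≠ 0
  inter_eq : Ω ∩ U = {y ∈ U | φ y < 0}
  frontier_inter_eq : frontier Ω ∩ U = {y ∈ U | φ y = 0}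

/-- `v` is the outer unit normal `∇φ / |∇φ|` of `Ω` at its regular boundary point `x`. -/
def IsOuterUnitNormal (Ω : Set (EuclideanSpace ℝ ι)) (x v : EuclideanSpace ℝ ι) : Prop :=
  ∃ U φ, IsLocalDefiningFunction Ω x U φ ∧ v = ‖gradient φ x‖⁻¹ • gradient φ x

/-- The regular boundary points: those near which the boundary is a `C¹` hypersurface with `Ω` on
one side of it. -/
def regularBoundary (Ω : Set (EuclideanSpace ℝ ι)) : Set (EuclideanSpace ℝ ι) :=
  {x | ∃ v, IsOuterUnitNormal Ω x v}

open Classical in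
/-- The outer unit normal field of `Ω`, given the value `0` off the regular boundary points. -/
def outerUnitNormal (Ω : Set (EuclideanSpace ℝ ι)) (x : EuclideanSpace ℝ ι) :
    EuclideanSpace ℝ ι :=
  if h : ∃ v, IsOuterUnitNormal Ω x v then h.choose else 0

/-- The surface measure `dS` on the boundary of `Ω ⊆ ℝ^N`: the `(N-1)`-dimensional Hausdorff
measure (normalised to agree with Lebesgue measure in `ℝ^{N-1}`), restricted to the boundary. -/
def surfaceMeasure (Ω : Set (EuclideanSpace ℝ ι)) : Measure (EuclideanSpace ℝ ι) :=
  (Measure.euclideanHausdorffMeasure (Fintype.card ι - 1)).restrict (frontier Ω)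

/-- An admissible domain: a bounded connected open set whose boundary is piecewise smooth and
simple. The latter means that the boundary has finite area and, off a set of zero area (the edges
and corners, a relatively closed set), is locally a `C¹` hypersurface with the domain on exactly one
side of it. -/
structure IsAdmissibleDomain (Ω : Set (EuclideanSpace ℝ ι)) : Prop where
  isOpen : IsOpen Ω
  isConnected : IsConnected Ω
  isBounded : Bornology.IsBounded Ω
  finite_area : surfaceMeasure Ω (frontier Ω) < ⊤
  singular_null : surfaceMeasure Ω (frontier Ω \ regularBoundary Ω) = 0

/-- If `φ` and `ψ` are local defining functions of `Ω` at the same point, then a direction along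
which `φ` decreases is not one along which `ψ` increases. -/
theorem IsLocalDefiningFunction.inner_nonpos {Ω : Set (EuclideanSpace ℝ ι)}
    {x : EuclideanSpace ℝ ι} {U U' : Set (EuclideanSpace ℝ ι)} {φ ψ : EuclideanSpace ℝ ι → ℝ}
    (hφ : IsLocalDefiningFunction Ω x U φ) (hψ : IsLocalDefiningFunction Ω x U' ψ)
    {v : EuclideanSpace ℝ ι} (hv : ⟪gradient φ x, v⟫ < 0) : ⟪gradient ψ x, v⟫ ≤ 0 := by
  have key : ∀ {U : Set (EuclideanSpace ℝ ι)} {φ : EuclideanSpace ℝ ι → ℝ},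
      IsLocalDefiningFunction Ω x U φ →
      HasDerivAt (fun t : ℝ => φ (x + t • v)) ⟪gradient φ x, v⟫ 0 ∧ φ x = 0 ∧
      (∀ᶠ t : ℝ in 𝓝 0, x + t • v ∈ U) := by
    intro U φ h
    have hU : U ∈ 𝓝 x := h.isOpen.mem_nhds h.mem
    have hd : DifferentiableAt ℝ φ x := (h.contDiffOn.contDiffAt hU).differentiableAt (by simp)
    have hl : HasDerivAt (fun t : ℝ => x + t • v) v 0 := by
      simpa using ((hasDerivAt_id (0 : ℝ)).smul_const v).const_add x
    refine ⟨?_, ?_, ?_⟩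
    · have hg : HasFDerivAt φ (InnerProductSpace.toDual ℝ _ (gradient φ x)) (x + (0 : ℝ) • v) := by
        simpa using hd.hasGradientAt.hasFDerivAt
      exact hg.comp_hasDerivAt (0 : ℝ) hl
    · have : x ∈ frontier Ω ∩ U := ⟨h.mem_frontier, h.mem⟩
      rw [h.frontier_inter_eq] at this
      exact this.2
    · have hc : Tendsto (fun t : ℝ => x + t • v) (𝓝 0) (𝓝 x) := by
        simpa using hl.continuousAt.tendsto
      exact hc hU
  obtain ⟨d1, z1, e1⟩ := key hφ
  obtain ⟨d2, z2, e2⟩ := key hψ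
  by_contra! hpos
  have s1 : ∀ᶠ t : ℝ in 𝓝[>] 0, φ (x + t • v) < 0 := by
    have := (hasDerivAt_iff_tendsto_slope.1 d1).mono_left
      (nhdsWithin_mono (0 : ℝ) (fun t (ht : 0 < t) => ne_of_gt ht))
    filter_upwards [this.eventually (gt_mem_nhds hv), self_mem_nhdsWithin] with t ht (h0 : 0 < t)
    rw [slope_def_field] at ht
    simp only [zero_smul, add_zero, z1, sub_zero] at ht
    by_contra! hc
    exact absurd ht (not_lt.2 (div_nonneg hc h0.le))
  have s2 : ∀ᶠ t : ℝ in 𝓝[>] 0, 0 < ψ (x + t • v) := by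
    have := (hasDerivAt_iff_tendsto_slope.1 d2).mono_left
      (nhdsWithin_mono (0 : ℝ) (fun t (ht : 0 < t) => ne_of_gt ht))
    filter_upwards [this.eventually (lt_mem_nhds hpos), self_mem_nhdsWithin] with t ht (h0 : 0 < t)
    rw [slope_def_field] at ht
    simp only [zero_smul, add_zero, z2, sub_zero] at ht
    by_contra! hc
    exact absurd ht (not_lt.2 (div_nonpos_of_nonpos_of_nonneg hc h0.le))
  obtain ⟨t, h1, h2, m1, m2⟩ := (s1.and (s2.and ((e1.filter_mono nhdsWithin_le_nhds).and
    (e2.filter_mono nhdsWithin_le_nhds)))).exists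
  have hΩ : x + t • v ∈ Ω ∩ U := by rw [hφ.inter_eq]; exact ⟨m1, h1⟩
  have hΩ' : x + t • v ∈ Ω ∩ U' := ⟨hΩ.1, m2⟩
  rw [hψ.inter_eq] at hΩ'
  exact absurd hΩ'.2 (not_lt.2 h2.le)

/-- The outer unit normal is unique. -/
theorem IsOuterUnitNormal.unique {Ω : Set (EuclideanSpace ℝ ι)} {x v w : EuclideanSpace ℝ ι}
    (hv : IsOuterUnitNormal Ω x v) (hw : IsOuterUnitNormal Ω x w) : v = w := by
  obtain ⟨U, φ, hφ, rfl⟩ := hv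
  obtain ⟨U', ψ, hψ, rfl⟩ := hw
  have hp := hφ.gradient_ne_zero x hφ.mem
  have hq := hψ.gradient_ne_zero x hψ.mem
  have np : 0 < ‖gradient φ x‖ := norm_pos_iff.2 hp
  have nq : 0 < ‖gradient ψ x‖ := norm_pos_iff.2 hq
  set p := ‖gradient φ x‖⁻¹ • gradient φ x with hpd
  set q := ‖gradient ψ x‖⁻¹ • gradient ψ x with hqd
  have p1 : ‖p‖ = 1 := norm_smul_inv_norm (𝕜 := ℝ) hp
  have q1 : ‖q‖ = 1 := norm_smul_inv_norm (𝕜 := ℝ) hq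
  by_contra hne
  have hlt : ⟪p, q⟫ < 1 := (inner_lt_one_iff_real_of_norm_eq_one p1 q1).2 hne
  have ep : gradient φ x = ‖gradient φ x‖ • p := by
    rw [hpd, smul_smul, mul_inv_cancel₀ np.ne', one_smul]
  have eq : gradient ψ x = ‖gradient ψ x‖ • q := by
    rw [hqd, smul_smul, mul_inv_cancel₀ nq.ne', one_smul]
  have h1 : ⟪gradient φ x, q - p⟫ < 0 := by
    rw [ep, real_inner_smul_left, inner_sub_right, real_inner_self_eq_norm_sq, p1]
    exact mul_neg_of_pos_of_neg np (by linarith)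
  have h2 := hφ.inner_nonpos hψ h1
  rw [eq, real_inner_smul_left, inner_sub_right, real_inner_self_eq_norm_sq, q1,
    real_inner_comm] at h2
  have : 0 < ‖gradient ψ x‖ * (1 ^ 2 - ⟪p, q⟫) := mul_pos nq (by linarith)
  linarith

/-- Contraction of the volume form. If `b` is an orthonormal frame and `b i` is the outer unit
normal, then inserting `X` in the place of `b i` in the volume form `dν = dx₁ ∧ ⋯ ∧ dx_N` gives
`⟪X, b i⟫ dν(b)`. So the restriction to the oriented boundary of the form `⟨X, dν⟩ = ι_X dν` is
`⟪X, v⟫ dS`, with `v` the outer unit normal. -/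
theorem volumeForm_update_eq [DecidableEq ι] (b : OrthonormalBasis ι ℝ (EuclideanSpace ℝ ι))
    (i : ι) (X : EuclideanSpace ℝ ι) :
    (EuclideanSpace.basisFun ι ℝ).toBasis.det (Function.update b i X) =
      ⟪X, b i⟫ * (EuclideanSpace.basisFun ι ℝ).toBasis.det b := by
  conv_lhs => rw [← b.sum_repr' X]
  rw [AlternatingMap.map_update_sum, Finset.sum_eq_single i]
  · rw [AlternatingMap.map_update_smul, Function.update_eq_self, real_inner_comm, smul_eq_mul]
  · intro j _ hj
    rw [AlternatingMap.map_update_smul, AlternatingMap.map_update_self _ _ hj.symm, smul_zero]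
  · simp

end Domains

/-! ### The boundary forms `⟨X_j, dν⟩` -/

/-- The density `∑ⱼ fⱼ ⟪Xⱼ, v⟫` with respect to the surface measure of the boundary measure
`∑ⱼ fⱼ ⟨Xⱼ, dν⟩`. Here `⟨Xⱼ, dν⟩` is the contraction of the volume form `dν` by `Xⱼ`, whose
restriction to the boundary is `⟪Xⱼ, v⟫ dS` with `v` the outer unit normal. -/
def boundaryDensity {r : ℕ} [NeZero r] (n : Fin r → ℕ) [Group (GradedSpace n)]
    {F : Type*} [NormedAddCommGroup F] [NormedSpace ℝ F] (Ω : Set (GradedSpace n))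
    (f : Fin (n 0) → GradedSpace n → F) (x : GradedSpace n) : F :=
  ∑ j : Fin (n 0), ⟪jacobianField n j x, outerUnitNormal Ω x⟫ • f j x

/-! ### Boundary value problems -/

/-- The class `C²(Ω) ∩ C¹(Ω̄)`: `u` is `C²` in the open set `Ω` and continuous on the closure, and
its first derivatives extend continuously to the closure. -/
structure IsC2InteriorC1Closure {E F : Type*} [NormedAddCommGroup E] [NormedSpace ℝ E]
    [NormedAddCommGroup F] [NormedSpace ℝ F] (Ω : Set E) (u : E → F) : Prop where
  contDiffOn : ContDiffOn ℝ 2 u Ω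
  continuousOn : ContinuousOn u (closure Ω)
  tendsto_fderiv : ∀ x ∈ closure Ω, ∃ L : E →L[ℝ] F, Tendsto (fderiv ℝ u) (𝓝[Ω] x) (𝓝 L)

/-- The derivative `X u` along a vector field, at points of the closure of the open set `Ω`, for
`u` in `C¹(Ω̄)`: on the boundary it is computed from the continuous extension of the derivative. -/
def closureDerivAlong {E F : Type*} [NormedAddCommGroup E] [NormedSpace ℝ E] [NormedAddCommGroup F]
    [NormedSpace ℝ F] (Ω : Set E) (X : E → E) (u : E → F) (x : E) : F :=
  extendFrom Ω (fderiv ℝ u) x (X x)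

/-- `u ∈ C²(Ω) ∩ C¹(Ω̄)` solves the mixed Dirichlet–Robin problem: `ℒ u = 0` in `Ω`, `u = 0` on
`Γ`, and `∑ⱼ (aⱼ u + Xⱼ u) ⟨Xⱼ, dν⟩ = 0` on `∂Ω \ Γ`. -/
structure IsDirichletRobinSolution {r : ℕ} [NeZero r] (n : Fin r → ℕ) [Group (GradedSpace n)]
    {𝕜 : Type*} [RCLike 𝕜] (Ω : Set (GradedSpace n)) (a : Fin (n 0) → GradedSpace n → ℝ)
    (Γ : Set (GradedSpace n)) (u : GradedSpace n → 𝕜) : Prop where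
  regular : IsC2InteriorC1Closure Ω u
  harmonic : ∀ x ∈ Ω, subLaplacian n u x = 0
  dirichlet : ∀ x ∈ Γ, u x = 0
  robin : ∀ᵐ x ∂surfaceMeasure Ω, x ∈ frontier Ω \ Γ →
    boundaryDensity n Ω
      (fun j y => (a j y : 𝕜) * u y + closureDerivAlong Ω (jacobianField n j) u y) x = 0

/-- `u ∈ C²(Ω) ∩ C¹(Ω̄)` solves the Robin problem: `ℒ u = 0` in `Ω` and
`∑ⱼ (aⱼ u + Xⱼ u) ⟨Xⱼ, dν⟩ = 0` on `∂Ω`. -/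
structure IsRobinSolution {r : ℕ} [NeZero r] (n : Fin r → ℕ) [Group (GradedSpace n)]
    {𝕜 : Type*} [RCLike 𝕜] (Ω : Set (GradedSpace n)) (a : Fin (n 0) → GradedSpace n → ℝ)
    (u : GradedSpace n → 𝕜) : Prop where
  regular : IsC2InteriorC1Closure Ω u
  harmonic : ∀ x ∈ Ω, subLaplacian n u x = 0
  robin : ∀ᵐ x ∂surfaceMeasure Ω, x ∈ frontier Ω →
    boundaryDensity n Ω
      (fun j y => (a j y : 𝕜) * u y + closureDerivAlong Ω (jacobianField n j) u y) x = 0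

end

/-! The proof is the energy method. For a solution `u` put F = ∑ⱼ Re(ū Xⱼu) Xⱼ. The generators are
divergence-free, so ℒu = 0 gives div F = ∑ⱼ |Xⱼu|² ≥ 0 in Ω. On the boundary, F·v equals -(∑ⱼ
aⱼ⟨Xⱼ,v⟩)|u|² ≤ 0 where the Robin condition holds and 0 where u = 0. If the integral of div F is at
most its outward flux, every Xⱼu vanishes. Then every iterated commutator kills u, and the rank
condition makes u constant on the connected set Ω, hence on its closure. A nonzero constant is
excluded by positive total mass of ∑ⱼ aⱼ⟨Xⱼ,dν⟩, or by a single Dirichlet point.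

The analytic content is the divergence theorem on a domain with singular boundary, for a field that
is C¹ only inside and continuous up to the boundary. No boundary integral is evaluated: since only a
sign is wanted, it is enough that F·v ≤ 0 implies ∫ (ζ div F + ∇ζ·F) ≤ 0 for test functions ζ ≥ 0.
Near a regular boundary point this follows by cutting ζ off in a strip of width δ along the boundary
(`exists_nhds_fluxPairing_nonpos`): the cutoff has gradient of order 1/δ, the strip has volume of
order δ, and the outward component of F there is at most a small ε. A partition of unity adds up the
local inequalities (`fluxPairing_nonpos`). The singular set is compact with zero (N-1)-dimensional
measure, so a cutoff η can vanish near it with ∫|∇η| arbitrarily small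
(`exists_cutoff_of_hausdorffMeasure_eq_zero`). Together these give
`IsAdmissibleDomain.divergence_eq_zero`.

On the group side, homogeneity under dilations yields div Xⱼ = 0 (`divergence_jacobianField`). -/

/-! ### The weak form of the divergence theorem -/

section Flux

variable {ι : Type*} [Fintype ι]

/-- The divergence `∑ᵢ ∂ᵢ Fᵢ` of a vector field. -/
noncomputable def divergence (F : EuclideanSpace ℝ ι → EuclideanSpace ℝ ι) (x : EuclideanSpace ℝ ι) : ℝ :=
  ∑ i, (fderiv ℝ F x (EuclideanSpace.basisFun ι ℝ i)) i

theorem divergence_smul {g : EuclideanSpace ℝ ι → ℝ} {F : EuclideanSpace ℝ ι → EuclideanSpace ℝ ι}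
    {x : EuclideanSpace ℝ ι} (hg : DifferentiableAt ℝ g x) (hF : DifferentiableAt ℝ F x) :
    divergence (fun y => g y • F y) x = g x * divergence F x + fderiv ℝ g x (F x) := by
  have hsum : F x = ∑ i, F x i • EuclideanSpace.basisFun ι ℝ i := by
    conv_lhs => rw [← (EuclideanSpace.basisFun ι ℝ).sum_repr (F x)]
    simp
  have h2 : fderiv ℝ g x (F x) = ∑ i, F x i * fderiv ℝ g x (EuclideanSpace.basisFun ι ℝ i) := by
    conv_lhs => rw [hsum, map_sum]
    simp
  rw [h2]
  simp only [divergence]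
  rw [fderiv_fun_smul hg hF, Finset.mul_sum, ← Finset.sum_add_distrib]
  refine Finset.sum_congr rfl fun i _ => ?_
  simp [mul_comm]

theorem divergence_sum {κ : Type*} (s : Finset κ)
    {G : κ → EuclideanSpace ℝ ι → EuclideanSpace ℝ ι} {x : EuclideanSpace ℝ ι}
    (hG : ∀ k ∈ s, DifferentiableAt ℝ (G k) x) :
    divergence (fun y => ∑ k ∈ s, G k y) x = ∑ k ∈ s, divergence (G k) x := by
  simp only [divergence]
  rw [fderiv_fun_sum hG, Finset.sum_comm]
  simp

theorem ContDiffOn.continuousOn_divergence {Ω : Set (EuclideanSpace ℝ ι)}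
    {F : EuclideanSpace ℝ ι → EuclideanSpace ℝ ι} (hF : ContDiffOn ℝ 1 F Ω) (hΩ : IsOpen Ω) :
    ContinuousOn (divergence F) Ω := by
  have := hF.continuousOn_fderiv_of_isOpen hΩ le_rfl
  refine continuousOn_finsetSum _ fun i _ => ?_
  have h2 : ContinuousOn (fun x => fderiv ℝ F x (EuclideanSpace.basisFun ι ℝ i)) Ω :=
    this.clm_apply continuousOn_const
  exact (EuclideanSpace.proj (𝕜 := ℝ) i).continuous.comp_continuousOn h2

/-- The integral of the divergence of a compactly supported `C¹` field vanishes. -/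
theorem integral_divergence_eq_zero {G : EuclideanSpace ℝ ι → EuclideanSpace ℝ ι}
    (hG : ContDiff ℝ 1 G) (hc : HasCompactSupport G) : ∫ x, divergence G x = 0 := by
  have hcont : ∀ i, Continuous fun x => (fderiv ℝ G x (EuclideanSpace.basisFun ι ℝ i)) i := by
    intro i
    exact (EuclideanSpace.proj (𝕜 := ℝ) i).continuous.comp
      ((hG.continuous_fderiv one_ne_zero).clm_apply continuous_const)
  have hcs : ∀ i, HasCompactSupport
      fun x => (fderiv ℝ G x (EuclideanSpace.basisFun ι ℝ i)) i := by
    intro i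
    refine (hc.fderiv (𝕜 := ℝ)).mono fun x hx => ?_
    contrapose! hx
    simp only [Function.mem_support, not_not] at hx
    simp [hx]
  have hGi : ∀ i, ContDiff ℝ 1 fun x => G x i := fun i =>
    (EuclideanSpace.proj (𝕜 := ℝ) i).contDiff.comp hG
  have hGs : ∀ i, HasCompactSupport fun x => G x i := by
    intro i
    refine hc.mono fun x hx => ?_
    contrapose! hx
    simp only [Function.mem_support, not_not] at hx
    simp [hx]
  have hint : ∀ i, ∫ x, (fderiv ℝ G x (EuclideanSpace.basisFun ι ℝ i)) i = 0 := by
    intro i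
    have hd : ∀ x, fderiv ℝ (fun x => G x i) x (EuclideanSpace.basisFun ι ℝ i) =
        (fderiv ℝ G x (EuclideanSpace.basisFun ι ℝ i)) i := by
      intro x
      have := ((EuclideanSpace.proj (𝕜 := ℝ) i).hasFDerivAt.comp x
        (hG.differentiable one_ne_zero x).hasFDerivAt).fderiv
      have h2 : fderiv ℝ (fun x => G x i) x = (EuclideanSpace.proj i).comp (fderiv ℝ G x) := this
      rw [h2]; rfl
    -- Integration by parts against the constant function 1.
    have := integral_mul_fderiv_eq_neg_fderiv_mul_of_integrable
      (μ := (volume : Measure (EuclideanSpace ℝ ι))) (f := fun _ => (1 : ℝ))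
      (g := fun x => G x i) (v := EuclideanSpace.basisFun ι ℝ i) (by simp)
      (by simpa only [one_mul, hd] using (hcont i).integrable_of_hasCompactSupport (hcs i))
      (by simpa only [one_mul] using
        (hGi i).continuous.integrable_of_hasCompactSupport (hGs i))
      (fun x _ => differentiableAt_const _) (fun x _ => (hGi i).differentiable one_ne_zero x)
    simpa only [one_mul, hd, fderiv_fun_const, Pi.zero_apply, _root_.zero_apply,
      zero_mul, integral_zero, neg_zero] using this
  simp only [divergence]
  rw [integral_finsetSum _ fun i _ => (hcont i).integrable_of_hasCompactSupport (hcs i)]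
  exact Finset.sum_eq_zero fun i _ => hint i

/-- A vector field in `C¹(Ω) ∩ C(Ω̄)` whose divergence is bounded in `Ω`. -/
structure HasBoundedDivergence (Ω : Set (EuclideanSpace ℝ ι))
    (F : EuclideanSpace ℝ ι → EuclideanSpace ℝ ι) : Prop where
  contDiffOn : ContDiffOn ℝ 1 F Ω
  continuousOn : ContinuousOn F (closure Ω)
  bounded : ∃ C, ∀ x ∈ Ω, |divergence F x| ≤ C

/-- The integral over `Ω` of the divergence of `ζ F`. -/
noncomputable def fluxPairing (Ω : Set (EuclideanSpace ℝ ι)) (F : EuclideanSpace ℝ ι → EuclideanSpace ℝ ι)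
    (ζ : EuclideanSpace ℝ ι → ℝ) : ℝ :=
  ∫ x in Ω, (ζ x * divergence F x + fderiv ℝ ζ x (F x))

variable {Ω : Set (EuclideanSpace ℝ ι)} {F : EuclideanSpace ℝ ι → EuclideanSpace ℝ ι}

theorem HasBoundedDivergence.exists_bound (hF : HasBoundedDivergence Ω F)
    (hb : Bornology.IsBounded Ω) {ζ : EuclideanSpace ℝ ι → ℝ} (hζ : ContDiff ℝ 1 ζ) :
    ∃ M, 0 ≤ M ∧ ∀ x ∈ Ω, |ζ x| * |divergence F x| + |fderiv ℝ ζ x (F x)| ≤ M := by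
  have hK : IsCompact (closure Ω) := hb.isCompact_closure
  obtain ⟨C, hC⟩ := hF.bounded
  obtain ⟨Z, hZ⟩ := hK.exists_bound_of_continuousOn hζ.continuous.continuousOn
  obtain ⟨D, hD⟩ := hK.exists_bound_of_continuousOn
    ((hζ.continuous_fderiv one_ne_zero).continuousOn.clm_apply hF.continuousOn)
  refine ⟨|Z| * |C| + |D|, by positivity, fun x hx => ?_⟩
  have h1 := hZ x (subset_closure hx)
  have h2 := hD x (subset_closure hx)
  rw [Real.norm_eq_abs] at h1 h2
  exact add_le_add (mul_le_mul (h1.trans (le_abs_self _)) ((hC x hx).trans (le_abs_self _))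
    (abs_nonneg _) (abs_nonneg _)) (h2.trans (le_abs_self _))

theorem HasBoundedDivergence.integrableOn (hF : HasBoundedDivergence Ω F) (hΩ : IsOpen Ω)
    (hb : Bornology.IsBounded Ω) {ζ : EuclideanSpace ℝ ι → ℝ} (hζ : ContDiff ℝ 1 ζ) :
    IntegrableOn (fun x => ζ x * divergence F x + fderiv ℝ ζ x (F x)) Ω := by
  obtain ⟨M, -, hM⟩ := hF.exists_bound hb hζ
  refine IntegrableOn.of_bound hb.measure_lt_top ?_ M ?_
  · refine ContinuousOn.aestronglyMeasurable ?_ hΩ.measurableSet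
    exact (hζ.continuous.continuousOn.mul (hF.contDiffOn.continuousOn_divergence hΩ)).add
      ((hζ.continuous_fderiv one_ne_zero).continuousOn.clm_apply
        (hF.continuousOn.mono subset_closure))
  · refine (ae_restrict_iff' hΩ.measurableSet).2 (Eventually.of_forall fun x hx => ?_)
    rw [Real.norm_eq_abs]
    refine (abs_add_le _ _).trans ?_
    rw [abs_mul]
    exact hM x hx

/-- ζF, which vanishes near every point outside Ω, is a compactly supported C¹ field on the whole
space, so interior regularity of F suffices. -/
theorem fluxPairing_eq_zero (hF : HasBoundedDivergence Ω F) (hΩ : IsOpen Ω)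
    {ζ : EuclideanSpace ℝ ι → ℝ} (hζ : ContDiff ℝ 1 ζ) (hc : HasCompactSupport ζ)
    (hs : tsupport ζ ⊆ Ω) : fluxPairing Ω F ζ = 0 := by
  have hd : ∀ x ∈ Ω, ContDiffAt ℝ 1 F x := fun x hx =>
    hF.contDiffOn.contDiffAt (hΩ.mem_nhds hx)
  have hG : ContDiff ℝ 1 fun x => ζ x • F x := by
    rw [contDiff_iff_contDiffAt]
    intro x
    by_cases hx : x ∈ tsupport ζ
    · exact hζ.contDiffAt.smul (hd x (hs hx))
    · have : (fun x => ζ x • F x) =ᶠ[𝓝 x] fun _ => 0 := by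
        filter_upwards [notMem_tsupport_iff_eventuallyEq.1 hx] with y hy
        simp [hy]
      exact contDiffAt_const.congr_of_eventuallyEq this
  have hGc : HasCompactSupport fun x => ζ x • F x := hc.smul_right
  have h0 := integral_divergence_eq_zero hG hGc
  have hzero : ∀ x, x ∉ Ω → divergence (fun x => ζ x • F x) x = 0 := by
    intro x hx
    have hx' : x ∉ tsupport ζ := fun h => hx (hs h)
    have : (fun x => ζ x • F x) =ᶠ[𝓝 x] fun _ => 0 := by
      filter_upwards [notMem_tsupport_iff_eventuallyEq.1 hx'] with y hy
      simp [hy]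
    simp [divergence, this.fderiv_eq]
  rw [← setIntegral_eq_integral_of_forall_compl_eq_zero (s := Ω) hzero] at h0
  rw [fluxPairing, ← h0]
  refine setIntegral_congr_fun hΩ.measurableSet fun x hx => ?_
  exact (divergence_smul (hζ.differentiable one_ne_zero x)
    ((hd x hx).differentiableAt one_ne_zero)).symm

/-! ### Volume of thin strips along a level set -/

theorem le_image_sub_of_le_fderiv {E : Type*} [NormedAddCommGroup E] [NormedSpace ℝ E]
    {φ : E → ℝ} {B : Set E} (hB : Convex ℝ B) {e : E} {c : ℝ}
    (hd : ∀ y ∈ B, DifferentiableAt ℝ φ y) (hc : ∀ y ∈ B, c ≤ fderiv ℝ φ y e) {x : E} {t : ℝ}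
    (ht : 0 ≤ t) (hx : x ∈ B) (hxt : x + t • e ∈ B) : φ x + c * t ≤ φ (x + t • e) := by
  have hmem : ∀ s ∈ Icc (0 : ℝ) t, x + s • e ∈ B := by
    intro s hs
    rcases ht.eq_or_lt with rfl | ht0
    · have : s = 0 := le_antisymm hs.2 hs.1
      simpa [this] using hx
    · have h := hB.add_smul_sub_mem hx hxt (t := s / t)
        ⟨div_nonneg hs.1 ht, div_le_one_of_le₀ hs.2 ht⟩
      have h2 : (s / t) • (x + t • e - x) = s • e := by
        rw [add_sub_cancel_left, smul_smul, div_mul_cancel₀ _ ht0.ne']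
      rwa [h2] at h
  have hder : ∀ s ∈ Icc (0 : ℝ) t,
      HasDerivAt (fun s : ℝ => φ (x + s • e)) (fderiv ℝ φ (x + s • e) e) s := by
    intro s hs
    have hl : HasDerivAt (fun s : ℝ => x + s • e) e s := by
      simpa using ((hasDerivAt_id s).smul_const e).const_add x
    exact (hd _ (hmem s hs)).hasFDerivAt.comp_hasDerivAt s hl
  have := (convex_Icc (0 : ℝ) t).mul_sub_le_image_sub_of_le_deriv
    (f := fun s : ℝ => φ (x + s • e)) (C := c)
    (fun s hs => (hder s hs).continuousAt.continuousWithinAt)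
    (fun s hs => (hder s (interior_subset hs)).differentiableAt.differentiableWithinAt)
    (fun s hs => by rw [(hder s (interior_subset hs)).deriv]; exact hc _ (hmem s (interior_subset hs)))
    0 (left_mem_Icc.2 ht) t (right_mem_Icc.2 ht) ht
  simp only [zero_smul, add_zero, sub_zero] at this
  linarith

/-- A strip `{-δ < φ < 0}` has volume `O(δ)` if `φ` increases at a positive rate in some
direction. -/
theorem exists_volume_strip_le {x₀ e : EuclideanSpace ℝ ι} {ρ c : ℝ} (hc0 : 0 < c)
    {φ : EuclideanSpace ℝ ι → ℝ} (hd : ∀ y ∈ Metric.ball x₀ ρ, DifferentiableAt ℝ φ y)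
    (hc : ∀ y ∈ Metric.ball x₀ ρ, c ≤ fderiv ℝ φ y e) :
    ∃ C, 0 ≤ C ∧ ∀ δ, 0 < δ → δ ≤ 1 →
      volume.real {x ∈ Metric.ball x₀ ρ | -δ < φ x ∧ φ x < 0} ≤ C * δ := by
  set R := ρ + (1 + 1 / c) * ‖e‖
  refine ⟨volume.real (Metric.ball x₀ R) / c, by positivity, fun δ hδ hδ1 => ?_⟩
  set A := {x ∈ Metric.ball x₀ ρ | -δ < φ x ∧ φ x < 0}
  have hA : IsOpen A := by
    have h1 : ContinuousOn φ (Metric.ball x₀ ρ) := fun y hy =>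
      (hd y hy).continuousAt.continuousWithinAt
    exact h1.isOpen_inter_preimage Metric.isOpen_ball (isOpen_Ioo (a := -δ) (b := 0))
  -- Translating by s • e raises φ by at least c s = δ, the height of the strip, so the translates
  -- by multiples of s • e are disjoint. About 1/s of them fit in the fixed ball of radius R, which
  -- bounds the volume of one by a multiple of s.
  set s := δ / c with hs
  have hs0 : 0 < s := by positivity
  set n := ⌈1 / s⌉₊
  have hn1 : 1 / s ≤ n := Nat.le_ceil _
  have hn2 : (n : ℝ) < 1 / s + 1 := Nat.ceil_lt_add_one (by positivity)
  let T : Fin n → Set (EuclideanSpace ℝ ι) := fun k => (fun x => x + ((k : ℝ) * s) • e) '' A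
  have hvol : ∀ k, volume (T k) = volume A := fun k => by
    simp [T, image_add_right, measure_preimage_add_right]
  have hTm : ∀ k, MeasurableSet (T k) := fun k =>
    ((Homeomorph.addRight (((k : ℝ) * s) • e)).isOpenMap A hA).measurableSet
  have hdisj' : ∀ k l : Fin n, k < l → Disjoint (T k) (T l) := by
    intro k l hkl
    rw [Set.disjoint_left]
    rintro _ ⟨x, hx, rfl⟩ ⟨y, hy, hxy⟩
    have hxy' : y + (((l : ℝ) - k) * s) • e = x := by
      have hxy : y + ((l : ℝ) * s) • e = x + ((k : ℝ) * s) • e := hxy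
      rw [sub_mul, sub_smul, ← add_sub_assoc, hxy, add_sub_cancel_right]
    have hkl' : (1 : ℝ) ≤ (l : ℝ) - k := by
      have : ((k : ℕ) : ℝ) + 1 ≤ (l : ℕ) := by exact_mod_cast hkl
      linarith
    have h := le_image_sub_of_le_fderiv (convex_ball x₀ ρ) hd hc (x := y)
      (t := ((l : ℝ) - k) * s) (by positivity) hy.1 (by rw [hxy']; exact hx.1)
    rw [hxy'] at h
    have h3 : δ ≤ c * (((l : ℝ) - k) * s) := by
      have : c * s = δ := by rw [hs]; field_simp
      nlinarith
    linarith [hx.2.2, hy.2.1]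
  have hdisj : Pairwise (Function.onFun Disjoint T) := by
    intro k l hkl
    rcases lt_or_gt_of_ne hkl with h | h
    · exact hdisj' k l h
    · exact (hdisj' l k h).symm
  have hsub : ⋃ k, T k ⊆ Metric.ball x₀ R := by
    refine iUnion_subset fun k => ?_
    rintro _ ⟨x, hx, rfl⟩
    have hx1 := hx.1
    rw [Metric.mem_ball, dist_eq_norm] at hx1 ⊢
    have hk : (k : ℝ) * s ≤ 1 + 1 / c := by
      have h1 : (k : ℝ) ≤ 1 / s + 1 := by
        have : ((k : ℕ) : ℝ) ≤ n := by exact_mod_cast k.2.le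
        linarith
      have h2 : s ≤ 1 / c := by rw [hs]; gcongr
      calc (k : ℝ) * s ≤ (1 / s + 1) * s := by gcongr
        _ = 1 + s := by field_simp
        _ ≤ _ := by linarith
    calc ‖x + ((k : ℝ) * s) • e - x₀‖ = ‖(x - x₀) + ((k : ℝ) * s) • e‖ := by congr 1; abel
      _ ≤ ‖x - x₀‖ + ‖((k : ℝ) * s) • e‖ := norm_add_le _ _
      _ = ‖x - x₀‖ + (k : ℝ) * s * ‖e‖ := by
        rw [norm_smul, Real.norm_of_nonneg (by positivity)]
      _ < ρ + (1 + 1 / c) * ‖e‖ := add_lt_add_of_lt_of_le hx1 (by gcongr)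
  have hsum : (n : ENNReal) * volume A ≤ volume (Metric.ball x₀ R) := by
    calc (n : ENNReal) * volume A = ∑ k : Fin n, volume (T k) := by simp [hvol]
      _ = volume (⋃ k, T k) := by rw [measure_iUnion hdisj hTm, tsum_fintype]
      _ ≤ _ := measure_mono hsub
  have hreal : (n : ℝ) * volume.real A ≤ volume.real (Metric.ball x₀ R) := by
    have := ENNReal.toReal_mono measure_ball_lt_top.ne hsum
    simpa [Measure.real] using this
  have h4 : 1 / s * volume.real A ≤ volume.real (Metric.ball x₀ R) :=
    (mul_le_mul_of_nonneg_right hn1 measureReal_nonneg).trans hreal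
  have h5 : volume.real A ≤ volume.real (Metric.ball x₀ R) * s := by
    rw [one_div, inv_mul_le_iff₀ hs0] at h4
    linarith
  calc volume.real A ≤ _ := h5
    _ = _ := by rw [hs]; ring

end Flux

/-! ### Boundary cutoffs -/

section Cutoff

variable {ι : Type*} [Fintype ι]

/-- The derivative is continuous and vanishes outside [0, 1]. The bound controls the gradient of the
strip cutoff. -/
theorem exists_deriv_smoothTransition_le :
    ∃ C, 0 ≤ C ∧ ∀ t, deriv Real.smoothTransition t ≤ C := by
  have hcont : Continuous (deriv Real.smoothTransition) :=
    (Real.smoothTransition.contDiff (n := 1)).continuous_deriv le_rfl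
  have hsupp : HasCompactSupport (deriv Real.smoothTransition) := by
    refine HasCompactSupport.intro (isCompact_Icc (a := (0 : ℝ)) (b := 1)) fun t ht => ?_
    rw [mem_Icc, not_and_or, not_le, not_le] at ht
    rcases ht with ht | ht
    · have : Real.smoothTransition =ᶠ[𝓝 t] fun _ => 0 := by
        filter_upwards [Iio_mem_nhds ht] with s hs
        exact Real.smoothTransition.zero_of_nonpos (le_of_lt hs)
      simp [this.deriv_eq]
    · have : Real.smoothTransition =ᶠ[𝓝 t] fun _ => 1 := by
        filter_upwards [Ioi_mem_nhds ht] with s hs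
        exact Real.smoothTransition.one_of_one_le (le_of_lt hs)
      simp [this.deriv_eq]
  obtain ⟨C, hC⟩ := hsupp.exists_bound_of_continuous hcont
  refine ⟨|C|, abs_nonneg _, fun t => ?_⟩
  exact (le_abs_self _).trans ((hC t).trans (le_abs_self _))

theorem IsLocalDefiningFunction.fderiv_eq_inner {Ω U : Set (EuclideanSpace ℝ ι)}
    {x : EuclideanSpace ℝ ι} {φ : EuclideanSpace ℝ ι → ℝ} (hφ : IsLocalDefiningFunction Ω x U φ)
    {y : EuclideanSpace ℝ ι} (hy : y ∈ U) (w : EuclideanSpace ℝ ι) :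
    fderiv ℝ φ y w = ⟪gradient φ y, w⟫ := by
  have : DifferentiableAt ℝ φ y :=
    (hφ.contDiffOn.contDiffAt (hφ.isOpen.mem_nhds hy)).differentiableAt one_ne_zero
  rw [this.hasGradientAt.hasFDerivAt.fderiv]
  simp

/-- If `F` does not point outwards on the boundary near a regular boundary point, then the total
divergence of `ζ F` is nonpositive for nonnegative `ζ` supported near that point. -/
theorem exists_nhds_fluxPairing_nonpos {Ω : Set (EuclideanSpace ℝ ι)}
    {F : EuclideanSpace ℝ ι → EuclideanSpace ℝ ι} (hΩ : IsOpen Ω) (hb : Bornology.IsBounded Ω)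
    (hF : HasBoundedDivergence Ω F) {x₀ : EuclideanSpace ℝ ι} {U : Set (EuclideanSpace ℝ ι)}
    {φ : EuclideanSpace ℝ ι → ℝ} (hφ : IsLocalDefiningFunction Ω x₀ U φ)
    (hsign : ∀ y ∈ frontier Ω ∩ U, fderiv ℝ φ y (F y) ≤ 0) :
    ∃ ρ > 0, ∀ ζ : EuclideanSpace ℝ ι → ℝ, ContDiff ℝ 1 ζ → (∀ x, 0 ≤ ζ x) →
      tsupport ζ ⊆ Metric.ball x₀ ρ → fluxPairing Ω F ζ ≤ 0 := by
  have hUo := hφ.isOpen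
  have hdφ : ∀ y ∈ U, ContDiffAt ℝ 1 φ y := fun y hy =>
    hφ.contDiffOn.contDiffAt (hUo.mem_nhds hy)
  have hφ' : ContinuousOn (fderiv ℝ φ) U := hφ.contDiffOn.continuousOn_fderiv_of_isOpen hUo le_rfl
  -- By continuity φ still increases along its gradient at x₀, at half the rate, throughout a small
  -- ball; this is what the strip estimate requires.
  set e := gradient φ x₀
  have he : 0 < fderiv ℝ φ x₀ e := by
    rw [hφ.fderiv_eq_inner hφ.mem, real_inner_self_eq_norm_sq]
    have := norm_pos_iff.2 (hφ.gradient_ne_zero x₀ hφ.mem)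
    positivity
  set c := fderiv ℝ φ x₀ e / 2 with hc
  have hc0 : 0 < c := by positivity
  have hev : ∀ᶠ y in 𝓝 x₀, y ∈ U ∧ c < fderiv ℝ φ y e := by
    refine (hUo.eventually_mem hφ.mem).and ?_
    have h1 : ContinuousAt (fun y => fderiv ℝ φ y e) x₀ :=
      ((hφ'.continuousAt (hUo.mem_nhds hφ.mem)).clm_apply continuousAt_const)
    exact h1.eventually (lt_mem_nhds (by rw [hc]; linarith))
  obtain ⟨ρ, hρ, hball⟩ := Metric.eventually_nhds_iff_ball.1 hev
  obtain ⟨V, hV0, hV⟩ := exists_volume_strip_le (x₀ := x₀) (e := e) (ρ := ρ) hc0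
    (fun y hy => (hdφ y (hball y hy).1).differentiableAt one_ne_zero)
    (fun y hy => (hball y hy).2.le)
  refine ⟨ρ, hρ, fun ζ hζ hζ0 hζs => ?_⟩
  have hζU : tsupport ζ ⊆ U := fun x hx => (hball x (hζs hx)).1
  have hζc : IsCompact (tsupport ζ) := by
    refine Metric.isCompact_of_isClosed_isBounded (isClosed_tsupport ζ) ?_
    exact Metric.isBounded_ball.subset hζs
  obtain ⟨M, hM0, hM⟩ := hF.exists_bound hb hζ
  obtain ⟨C, hC0, hC⟩ := exists_deriv_smoothTransition_le
  obtain ⟨Z, hZ⟩ := hζc.exists_bound_of_continuousOn hζ.continuous.continuousOn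
  have hφneg : ∀ x ∈ Ω, x ∈ U → φ x < 0 := fun x hx hxU => by
    have : x ∈ Ω ∩ U := ⟨hx, hxU⟩
    rw [hφ.inter_eq] at this
    exact this.2
  -- the outward component of `F` is small near the boundary
  have hsmall : ∀ ε > 0, ∃ m > 0, ∀ x ∈ tsupport ζ ∩ Ω, -m < φ x → fderiv ℝ φ x (F x) < ε := by
    intro ε hε
    have hg : ContinuousOn (fun x => fderiv ℝ φ x (F x)) (tsupport ζ ∩ closure Ω) :=
      (hφ'.mono (inter_subset_left.trans hζU)).clm_apply (hF.continuousOn.mono inter_subset_right)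
    have hKc : IsCompact (tsupport ζ ∩ closure Ω) := hζc.inter_right isClosed_closure
    -- The points where the outward component is at least ε form a compact set missing the boundary.
    -- Hence φ has a negative maximum there, and its absolute value is the required m.
    have hA : IsCompact ((tsupport ζ ∩ closure Ω) ∩ (fun x => fderiv ℝ φ x (F x)) ⁻¹' Ici ε) := by
      refine hKc.of_isClosed_subset ?_ inter_subset_left
      exact hg.preimage_isClosed_of_isClosed hKc.isClosed isClosed_Ici
    rcases ((tsupport ζ ∩ closure Ω) ∩
      (fun x => fderiv ℝ φ x (F x)) ⁻¹' Ici ε).eq_empty_or_nonempty with hE | hE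
    · refine ⟨1, one_pos, fun x hx _ => ?_⟩
      by_contra! hcon
      exact notMem_empty x (hE ▸ ⟨⟨hx.1, subset_closure hx.2⟩, hcon⟩)
    · obtain ⟨z, hz, hzmax⟩ := hA.exists_isMaxOn hE
        (hφ.contDiffOn.continuousOn.mono fun x hx => hζU hx.1.1)
      have hzU := hζU hz.1.1
      have hzΩ : z ∈ Ω := by
        by_contra hcon
        have hzf : z ∈ frontier Ω := by
          rw [hΩ.frontier_eq]; exact ⟨hz.1.2, hcon⟩
        have h1 := hsign z ⟨hzf, hzU⟩
        have h2 : ε ≤ fderiv ℝ φ z (F z) := hz.2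
        linarith
      refine ⟨-φ z, neg_pos.2 (hφneg z hzΩ hzU), fun x hx hxm => ?_⟩
      by_contra! hcon
      have : φ x ≤ φ z := hzmax ⟨⟨hx.1, subset_closure hx.2⟩, hcon⟩
      linarith
  have key : ∀ ε > 0, ε ≤ 1 → fluxPairing Ω F ζ ≤ (M * (3 * V) + |Z| * C * (3 * V)) * ε := by
    intro ε hε hε1
    obtain ⟨m, hm, hmε⟩ := hsmall ε hε
    -- The strip of width 3δ must lie where the outward component is below ε, and the term M · 3δ
    -- must be at most a multiple of ε.
    set δ := min (ε / 3) (m / 3) with hδ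
    have hδ0 : 0 < δ := lt_min (by positivity) (by positivity)
    have hδm : 3 * δ ≤ m := by have := min_le_right (ε / 3) (m / 3); linarith
    have hδε : 3 * δ ≤ ε := by have := min_le_left (ε / 3) (m / 3); linarith
    -- The cutoff is 0 where φ ≥ -δ and 1 where φ ≤ -2δ, so h is supported inside Ω and its pairing
    -- vanishes.
    set τ : EuclideanSpace ℝ ι → ℝ := fun x => -φ x / δ - 1 with hτ
    set h : EuclideanSpace ℝ ι → ℝ := fun x => ζ x * Real.smoothTransition (τ x) with hh
    have hτU : ∀ x ∈ U, ContDiffAt ℝ 1 τ x := fun x hx =>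
      (((hdφ x hx).neg).div_const δ).sub contDiffAt_const
    have hσ : ContDiff ℝ 1 Real.smoothTransition := Real.smoothTransition.contDiff (n := 1)
    have hoff : ∀ x, x ∉ tsupport ζ → h =ᶠ[𝓝 x] fun _ => 0 := fun x hx => by
      filter_upwards [notMem_tsupport_iff_eventuallyEq.1 hx] with y hy
      simp [hh, hy]
    have hh1 : ContDiff ℝ 1 h := by
      rw [contDiff_iff_contDiffAt]
      intro x
      by_cases hx : x ∈ tsupport ζ
      · exact hζ.contDiffAt.mul (hσ.contDiffAt.comp x (hτU x (hζU hx)))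
      · exact contDiffAt_const.congr_of_eventuallyEq (hoff x hx)
    have hclosed : IsClosed (tsupport ζ ∩ φ ⁻¹' Iic (-δ)) :=
      (hφ.contDiffOn.continuousOn.mono hζU).preimage_isClosed_of_isClosed
        (isClosed_tsupport ζ) isClosed_Iic
    have hsupp : tsupport h ⊆ tsupport ζ ∩ φ ⁻¹' Iic (-δ) := by
      refine closure_minimal (fun x hx => ?_) hclosed
      have hx1 : ζ x ≠ 0 := left_ne_zero_of_mul hx
      have hx2 : Real.smoothTransition (τ x) ≠ 0 := right_ne_zero_of_mul hx
      refine ⟨subset_tsupport _ hx1, ?_⟩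
      by_contra hcon
      rw [mem_preimage, mem_Iic, not_le] at hcon
      refine hx2 (Real.smoothTransition.zero_of_nonpos ?_)
      have : -φ x / δ ≤ 1 := by rw [div_le_one hδ0]; linarith
      simp only [hτ]; linarith
    have hzero : fluxPairing Ω F h = 0 := by
      refine fluxPairing_eq_zero hF hΩ hh1 ?_ fun x hx => ?_
      · exact hζc.of_isClosed_subset (isClosed_tsupport h) (hsupp.trans inter_subset_left)
      · have h1 := hsupp hx
        have : x ∈ {y ∈ U | φ y < 0} := ⟨hζU h1.1, lt_of_le_of_lt h1.2 (neg_lt_zero.2 hδ0)⟩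
        rw [← hφ.inter_eq] at this
        exact this.1
    -- Width 3δ instead of 2δ makes τ > 1 strictly below the strip, so that h = ζ in a neighbourhood
    -- and the derivatives agree as well.
    set A := {x ∈ Metric.ball x₀ ρ | -(3 * δ) < φ x ∧ φ x < 0} with hA
    have hAo : IsOpen A := by
      have h1 : ContinuousOn φ (Metric.ball x₀ ρ) := fun y hy =>
        (hdφ y (hball y hy).1).continuousAt.continuousWithinAt
      exact h1.isOpen_inter_preimage Metric.isOpen_ball (isOpen_Ioo (a := -(3 * δ)) (b := 0))
    set K := M + |Z| * C * ε / δ with hK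
    have hK0 : 0 ≤ K := by positivity
    -- On the strip the difference is (1 - σ)(ζ div F + ∇ζ·F) + ζ σ' (∇φ·F)/δ, where σ is the
    -- transition function at τ. As ζ and σ' are nonnegative, the one-sided bound ∇φ·F ≤ ε is
    -- enough.
    have hpt : ∀ x ∈ Ω, (ζ x * divergence F x + fderiv ℝ ζ x (F x)) -
        (h x * divergence F x + fderiv ℝ h x (F x)) ≤ A.indicator (fun _ => K) x := by
      intro x hx
      have hind : 0 ≤ A.indicator (fun _ => K) x := indicator_nonneg (fun _ _ => hK0) x
      by_cases hxs : x ∈ tsupport ζ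
      · have hxU := hζU hxs
        have hneg := hφneg x hx hxU
        have hτd := ((hτU x hxU).differentiableAt one_ne_zero)
        have hτ' : fderiv ℝ τ x = (-δ⁻¹) • fderiv ℝ φ x := by
          have h1 : HasFDerivAt τ ((δ⁻¹) • (-fderiv ℝ φ x)) x := by
            have h2 := ((((hdφ x hxU).differentiableAt one_ne_zero).hasFDerivAt.neg).const_mul
              δ⁻¹).sub_const 1
            refine h2.congr_of_eventuallyEq (Eventually.of_forall fun y => ?_)
            simp [hτ, div_eq_inv_mul]
          rw [h1.fderiv]; simp
        by_cases hxA : x ∈ A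
        · rw [indicator_of_mem hxA]
          have hderiv : fderiv ℝ h x (F x) = Real.smoothTransition (τ x) * fderiv ℝ ζ x (F x) -
              ζ x * deriv Real.smoothTransition (τ x) * (δ⁻¹ * fderiv ℝ φ x (F x)) := by
            have h1 : HasFDerivAt (fun y => Real.smoothTransition (τ y))
                (deriv Real.smoothTransition (τ x) • fderiv ℝ τ x) x :=
              ((hσ.differentiable one_ne_zero _).hasDerivAt).comp_hasFDerivAt x hτd.hasFDerivAt
            have h2 := ((hζ.differentiable one_ne_zero x).hasFDerivAt.mul h1).fderiv
            have h3 : fderiv ℝ h x = _ := h2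
            rw [h3, hτ']
            simp
            ring
          rw [hderiv]
          have hs0 := Real.smoothTransition.nonneg (τ x)
          have hs1 := Real.smoothTransition.le_one (τ x)
          have hd0 : 0 ≤ deriv Real.smoothTransition (τ x) :=
            Real.smoothTransition.monotone.deriv_nonneg
          have hM' : (1 - Real.smoothTransition (τ x)) *
              (ζ x * divergence F x + fderiv ℝ ζ x (F x)) ≤ M := by
            have h1 : |(1 - Real.smoothTransition (τ x)) *
                (ζ x * divergence F x + fderiv ℝ ζ x (F x))| ≤ 1 * M := by
              rw [abs_mul]
              refine mul_le_mul ?_ ?_ (abs_nonneg _) zero_le_one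
              · rw [abs_le]; constructor <;> linarith
              · refine (abs_add_le _ _).trans ?_
                rw [abs_mul]
                exact hM x hx
            exact (le_abs_self _).trans (by linarith)
          have hζZ : ζ x ≤ |Z| := (le_abs_self _).trans ((hZ x hxs).trans (le_abs_self _))
          have h4 : fderiv ℝ φ x (F x) ≤ ε := (hmε x ⟨hxs, hx⟩ (by linarith [hxA.2.1])).le
          have h5 : ζ x * deriv Real.smoothTransition (τ x) * (δ⁻¹ * fderiv ℝ φ x (F x)) ≤
              |Z| * C * ε / δ := by
            calc _ ≤ ζ x * deriv Real.smoothTransition (τ x) * (δ⁻¹ * ε) := by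
                  have := hζ0 x
                  gcongr
              _ ≤ |Z| * C * (δ⁻¹ * ε) := by
                  have := hC (τ x)
                  have := hζ0 x
                  gcongr
              _ = _ := by rw [div_eq_mul_inv]; ring
          rw [hK]
          calc _ = (1 - Real.smoothTransition (τ x)) *
              (ζ x * divergence F x + fderiv ℝ ζ x (F x)) +
              ζ x * deriv Real.smoothTransition (τ x) * (δ⁻¹ * fderiv ℝ φ x (F x)) := by ring
            _ ≤ _ := add_le_add hM' h5
        · have hle : φ x ≤ -(3 * δ) := by
            by_contra! hcon
            exact hxA ⟨hζs hxs, hcon, hneg⟩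
          have hτ1 : 1 < τ x := by
            have : 3 ≤ -φ x / δ := by rw [le_div_iff₀ hδ0]; linarith
            simp only [hτ]; linarith
          have heq : h =ᶠ[𝓝 x] ζ := by
            filter_upwards [hτd.continuousAt.eventually (lt_mem_nhds hτ1)] with y hy
            simp [hh, Real.smoothTransition.one_of_one_le hy.le]
          rw [heq.fderiv_eq, heq.eq_of_nhds, sub_self]
          exact hind
      · have heq := hoff x hxs
        have heq' := notMem_tsupport_iff_eventuallyEq.1 hxs
        rw [heq.fderiv_eq, heq.eq_of_nhds, heq'.fderiv_eq, heq'.eq_of_nhds]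
        simpa using hind
    have hi1 := hF.integrableOn hΩ hb hζ
    have hi2 := hF.integrableOn hΩ hb hh1
    have hAfin : volume (A ∩ Ω) < ⊤ := (hb.subset inter_subset_right).measure_lt_top
    have hint : IntegrableOn (A.indicator fun _ => K) Ω := by
      refine (integrable_indicator_iff hAo.measurableSet).2 ?_
      refine integrableOn_const (hs := ?_)
      rw [Measure.restrict_apply hAo.measurableSet]
      exact hAfin.ne
    have hle := setIntegral_mono_on (hi1.sub hi2) hint hΩ.measurableSet hpt
    rw [Pi.sub_def] at hle
    rw [integral_sub hi1 hi2] at hle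
    have hle' : fluxPairing Ω F ζ - fluxPairing Ω F h ≤ volume.real (A ∩ Ω) * K := by
      refine hle.trans_eq ?_
      rw [integral_indicator hAo.measurableSet, setIntegral_const, Measure.real,
        Measure.restrict_apply hAo.measurableSet, smul_eq_mul, Measure.real]
    rw [hzero, sub_zero] at hle'
    have hvol : volume.real (A ∩ Ω) ≤ V * (3 * δ) := by
      refine le_trans (measureReal_mono inter_subset_left ?_) (hV (3 * δ) (by positivity)
        (hδε.trans hε1))
      exact ((Metric.isBounded_ball.subset fun x hx => hx.1).measure_lt_top).ne
    calc fluxPairing Ω F ζ ≤ volume.real (A ∩ Ω) * K := hle'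
      _ ≤ V * (3 * δ) * K := by gcongr
      _ = M * V * (3 * δ) + |Z| * C * (3 * V) * ε := by rw [hK]; field_simp
      _ ≤ M * V * (3 * ε) + |Z| * C * (3 * V) * ε := by
        gcongr
        linarith
      _ = _ := by ring
  refine le_of_forall_pos_le_add fun η hη => ?_
  set B := M * (3 * V) + |Z| * C * (3 * V)
  have hB : 0 ≤ B := by positivity
  have h1 := key (min 1 (η / (B + 1))) (lt_min one_pos (by positivity)) (min_le_left _ _)
  rw [zero_add]
  calc fluxPairing Ω F ζ ≤ B * min 1 (η / (B + 1)) := h1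
    _ ≤ B * (η / (B + 1)) := by gcongr; exact min_le_right _ _
    _ ≤ (B + 1) * (η / (B + 1)) := by gcongr; linarith
    _ = η := by field_simp

end Cutoff

/-! ### Null sets of the surface measure -/

section SurfaceNull

variable {ι : Type*} [Fintype ι]

theorem euclideanHausdorffMeasure_eq_zero_iff {X : Type*} [EMetricSpace X] [MeasurableSpace X]
    [BorelSpace X] (d : ℕ) (s : Set X) :
    Measure.euclideanHausdorffMeasure d s = 0 ↔ Measure.hausdorffMeasure (d : ℝ) s = 0 := by
  rw [Measure.euclideanHausdorffMeasure_def, Measure.smul_apply, ENNReal.smul_def, smul_eq_mul,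
    mul_eq_zero, or_iff_right]
  exact_mod_cast Measure.addHaarScalarFactor_volume_hausdorffMeasure_ne_zero d

/-- Arbitrarily close to a point where its derivative does not vanish, a function takes values
below and above its value at the point. -/
theorem HasDerivAt.exists_lt_and_exists_gt {g : ℝ → ℝ} {g' : ℝ} (hg : HasDerivAt g g' 0)
    (h0 : g 0 = 0) (hne : g' ≠ 0) {r : ℝ} (hr : 0 < r) :
    (∃ s, |s| < r ∧ g s < 0) ∧ ∃ s, |s| < r ∧ 0 < g s := by
  have hball : ∀ᶠ s in 𝓝 (0 : ℝ), |s| < r := by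
    filter_upwards [Metric.ball_mem_nhds (0 : ℝ) hr] with s hs
    simpa using hs
  constructor
  · by_contra! hcon
    refine hne (IsLocalMin.hasDerivAt_eq_zero ?_ hg)
    filter_upwards [hball] with s hs
    rw [h0]
    exact hcon s hs
  · by_contra! hcon
    refine hne (IsLocalMax.hasDerivAt_eq_zero ?_ hg)
    filter_upwards [hball] with s hs
    rw [h0]
    exact hcon s hs

/-- The boundary has positive area near each of its regular points. -/
theorem IsLocalDefiningFunction.surfaceMeasure_ne_zero {Ω U : Set (EuclideanSpace ℝ ι)}
    {x₀ : EuclideanSpace ℝ ι} {φ : EuclideanSpace ℝ ι → ℝ}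
    (hφ : IsLocalDefiningFunction Ω x₀ U φ) {V : Set (EuclideanSpace ℝ ι)} (hV : IsOpen V)
    (hx₀ : x₀ ∈ V) : surfaceMeasure Ω V ≠ 0 := by
  classical
  intro hnull
  rw [surfaceMeasure, Measure.restrict_apply hV.measurableSet,
    euclideanHausdorffMeasure_eq_zero_iff] at hnull
  have hd : DifferentiableAt ℝ φ x₀ :=
    (hφ.contDiffOn.contDiffAt (hφ.isOpen.mem_nhds hφ.mem)).differentiableAt one_ne_zero
  have hφ0 : φ x₀ = 0 := by
    have : x₀ ∈ frontier Ω ∩ U := ⟨hφ.mem_frontier, hφ.mem⟩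
    rw [hφ.frontier_inter_eq] at this
    exact this.2
  obtain ⟨i, hi⟩ : ∃ i, fderiv ℝ φ x₀ (EuclideanSpace.basisFun ι ℝ i) ≠ 0 := by
    by_contra! hcon
    have h0 : fderiv ℝ φ x₀ = 0 := by
      have : (fderiv ℝ φ x₀ : EuclideanSpace ℝ ι →ₗ[ℝ] ℝ) = 0 :=
        (EuclideanSpace.basisFun ι ℝ).toBasis.ext fun i => by simpa using hcon i
      ext y
      exact congrArg (fun l : EuclideanSpace ℝ ι →ₗ[ℝ] ℝ => l y) this
    have h1 := hφ.fderiv_eq_inner hφ.mem (gradient φ x₀)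
    rw [h0, _root_.zero_apply] at h1
    exact hφ.gradient_ne_zero x₀ hφ.mem (inner_self_eq_zero.1 h1.symm)
  set e := EuclideanSpace.basisFun ι ℝ i with he
  have hne : ‖e‖ = 1 := (EuclideanSpace.basisFun ι ℝ).orthonormal.1 i
  obtain ⟨r, hr, hball⟩ := Metric.isOpen_iff.1 (hV.inter hφ.isOpen) x₀ ⟨hx₀, hφ.mem⟩
  have hg : HasDerivAt (fun s : ℝ => φ (x₀ + s • e)) (fderiv ℝ φ x₀ e) 0 := by
    have hl : HasDerivAt (fun s : ℝ => x₀ + s • e) e 0 := by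
      simpa using ((hasDerivAt_id (0 : ℝ)).smul_const e).const_add x₀
    have h1 : HasFDerivAt φ (fderiv ℝ φ x₀) (x₀ + (0 : ℝ) • e) := by
      simpa using hd.hasFDerivAt
    exact h1.comp_hasDerivAt (0 : ℝ) hl
  obtain ⟨⟨s₁, hs₁, hneg⟩, s₂, hs₂, hpos⟩ :=
    hg.exists_lt_and_exists_gt (by simpa using hφ0) hi (half_pos hr)
  have hmem : ∀ z ∈ Metric.ball x₀ (r / 2), ∀ s : ℝ, |s| < r / 2 → z + s • e ∈ V ∩ U := by
    intro z hz s hs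
    refine hball ?_
    rw [Metric.mem_ball, dist_eq_norm] at hz ⊢
    calc ‖z + s • e - x₀‖ = ‖(z - x₀) + s • e‖ := by congr 1; abel
      _ ≤ ‖z - x₀‖ + ‖s • e‖ := norm_add_le _ _
      _ < r / 2 + r / 2 := by
        rw [norm_smul, hne, mul_one, Real.norm_eq_abs]
        exact add_lt_add hz hs
      _ = r := add_halves r
  have hcφ : ∀ y ∈ U, ContinuousAt φ y := fun y hy =>
    (hφ.contDiffOn.contDiffAt (hφ.isOpen.mem_nhds hy)).continuousAt
  have hx₀m := Metric.mem_ball_self (x := x₀) (half_pos hr)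
  have hc : ∀ s : ℝ, |s| < r / 2 → ContinuousAt (fun z => φ (z + s • e)) x₀ := fun s hs =>
    ContinuousAt.comp (f := fun z => z + s • e) (hcφ _ (hmem x₀ hx₀m s hs).2) (by fun_prop)
  have hev : ∀ᶠ z in 𝓝 x₀, z ∈ Metric.ball x₀ (r / 2) ∧ φ (z + s₁ • e) < 0 ∧
      0 < φ (z + s₂ • e) :=
    (Metric.isOpen_ball.eventually_mem hx₀m).and
      (((hc s₁ hs₁).eventually (gt_mem_nhds hneg)).and ((hc s₂ hs₂).eventually (lt_mem_nhds hpos)))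
  obtain ⟨η, hη, hηb⟩ := Metric.eventually_nhds_iff_ball.1 hev
  -- P forgets the coordinate i, along which φ changes sign. Each nearby line in that direction
  -- meets the boundary, so the projection of the boundary contains a nonempty open set. P is
  -- Lipschitz, so a null boundary piece would have a null projection.
  let P : EuclideanSpace ℝ ι →L[ℝ] ({j // j ≠ i} → ℝ) :=
    ContinuousLinearMap.pi fun j => EuclideanSpace.proj (𝕜 := ℝ) (j : ι)
  have hPe : ∀ s : ℝ, P (s • e) = 0 := by
    intro s
    ext j
    simp [P, he, j.2]
  have hsub : P '' Metric.ball x₀ η ⊆ P '' (V ∩ frontier Ω) := by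
    rintro _ ⟨z, hz, rfl⟩
    obtain ⟨hz1, hz2, hz3⟩ := hηb z hz
    have hlt : ∀ s ∈ uIcc s₁ s₂, |s| < r / 2 := by
      intro s hs
      rw [abs_lt] at hs₁ hs₂ ⊢
      rw [mem_uIcc] at hs
      constructor <;> rcases hs with h | h <;> linarith [h.1, h.2, hs₁.1, hs₁.2, hs₂.1, hs₂.2]
    have hcont : ContinuousOn (fun s : ℝ => φ (z + s • e)) (uIcc s₁ s₂) := fun s hs =>
      (ContinuousAt.comp (f := fun s : ℝ => z + s • e) (hcφ _ (hmem z hz1 s (hlt s hs)).2)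
        (by fun_prop)).continuousWithinAt
    obtain ⟨s, hs, hs0⟩ := intermediate_value_uIcc hcont
      (Icc_subset_uIcc ⟨hz2.le, hz3.le⟩ : (0 : ℝ) ∈ _)
    have hm := hmem z hz1 s (hlt s hs)
    refine ⟨z + s • e, ⟨hm.1, ?_⟩, by rw [map_add, hPe, add_zero]⟩
    have : z + s • e ∈ {y ∈ U | φ y = 0} := ⟨hm.2, hs0⟩
    rw [← hφ.frontier_inter_eq] at this
    exact this.1
  have hPs : Function.Surjective P := by
    intro w
    refine ⟨WithLp.toLp 2 fun j => if h : j ≠ i then w ⟨j, h⟩ else 0, ?_⟩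
    ext j
    simp [P, j.2]
  have hopen : IsOpen (P '' Metric.ball x₀ η) := P.isOpenMap hPs _ Metric.isOpen_ball
  have hposv : 0 < volume (P '' Metric.ball x₀ η) :=
    hopen.measure_pos _ ⟨P x₀, x₀, Metric.mem_ball_self hη, rfl⟩
  have hcard : Fintype.card {j // j ≠ i} = Fintype.card ι - 1 := Set.card_ne_eq i
  have hle := (P.lipschitz.lipschitzOnWith (s := V ∩ frontier Ω)).hausdorffMeasure_image_le
    (d := ((Fintype.card ι - 1 : ℕ) : ℝ)) (Nat.cast_nonneg _)
  rw [hnull, mul_zero, ← hcard, hausdorffMeasure_pi_real] at hle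
  exact absurd (hposv.trans_le (measure_mono hsub)) (not_lt.2 hle)

/-- An almost everywhere inequality between continuous functions holds at every regular boundary
point. -/
theorem IsLocalDefiningFunction.fderiv_nonpos_of_ae {Ω U : Set (EuclideanSpace ℝ ι)}
    {F : EuclideanSpace ℝ ι → EuclideanSpace ℝ ι} (hF : ContinuousOn F (closure Ω))
    (hae : ∀ᵐ x ∂surfaceMeasure Ω, x ∈ frontier Ω → ⟪F x, outerUnitNormal Ω x⟫ ≤ 0)
    {x₀ : EuclideanSpace ℝ ι} {φ : EuclideanSpace ℝ ι → ℝ}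
    (hφ : IsLocalDefiningFunction Ω x₀ U φ) :
    ∀ y ∈ frontier Ω ∩ U, fderiv ℝ φ y (F y) ≤ 0 := by
  have hloc : ∀ y ∈ frontier Ω ∩ U, IsLocalDefiningFunction Ω y U φ := fun y hy =>
    ⟨hy.1, hφ.isOpen, hy.2, hφ.contDiffOn, hφ.gradient_ne_zero, hφ.inter_eq,
      hφ.frontier_inter_eq⟩
  have hnormal : ∀ y ∈ frontier Ω ∩ U,
      outerUnitNormal Ω y = ‖gradient φ y‖⁻¹ • gradient φ y := by
    intro y hy
    have hN : IsOuterUnitNormal Ω y (‖gradient φ y‖⁻¹ • gradient φ y) :=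
      ⟨U, φ, hloc y hy, rfl⟩
    have hex : ∃ v, IsOuterUnitNormal Ω y v := ⟨_, hN⟩
    rw [outerUnitNormal, dif_pos hex]
    exact hex.choose_spec.unique hN
  have hae' : ∀ᵐ x ∂surfaceMeasure Ω, x ∈ frontier Ω ∩ U → fderiv ℝ φ x (F x) ≤ 0 := by
    filter_upwards [hae] with x hx hxU
    have h1 := hx hxU.1
    rw [hnormal x hxU, real_inner_smul_right, real_inner_comm, ← hφ.fderiv_eq_inner hxU.2] at h1
    have h2 : 0 < ‖gradient φ x‖⁻¹ :=
      inv_pos.2 (norm_pos_iff.2 (hφ.gradient_ne_zero x hxU.2))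
    exact nonpos_of_mul_nonpos_right h1 h2
  intro y hy
  by_contra! hcon
  have hcont : ContinuousWithinAt (fun x => fderiv ℝ φ x (F x)) (frontier Ω ∩ U) y := by
    refine ContinuousWithinAt.clm_apply ?_ ?_
    · exact ((hφ.contDiffOn.continuousOn_fderiv_of_isOpen hφ.isOpen le_rfl) y hy.2).mono
        inter_subset_right
    · exact (hF y (frontier_subset_closure hy.1)).mono
        (inter_subset_left.trans frontier_subset_closure)
  have hev := hcont.eventually (lt_mem_nhds hcon)
  obtain ⟨V, hVo, hyV, hV⟩ := mem_nhdsWithin.1 hev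
  -- A strict violation at y persists on a boundary neighbourhood of y, which has positive area;
  -- this contradicts the almost everywhere inequality.
  refine (hloc y hy).surfaceMeasure_ne_zero (hVo.inter hφ.isOpen) ⟨hyV, hy.2⟩ ?_
  have hfr : ∀ᵐ x ∂surfaceMeasure Ω, x ∈ frontier Ω :=
    ae_restrict_mem isClosed_frontier.measurableSet
  refine measure_mono_null ?_ (hae'.and hfr)
  rintro x ⟨hxV, hxU⟩ ⟨h1, h2⟩
  exact absurd (h1 ⟨h2, hxU⟩) (not_le.2 (hV ⟨hxV, h2, hxU⟩))

end SurfaceNull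

/-! ### Cutting off the singular set -/

section Singular

variable {ι : Type*} [Fintype ι]

/-- Rescaling one fixed bump function gives a gradient of order 1/r supported in a ball of volume of
order r^(d+1). -/
theorem exists_cutoff_ball (E : Type*) [NormedAddCommGroup E] [InnerProductSpace ℝ E]
    [FiniteDimensional ℝ E] [MeasurableSpace E] [BorelSpace E]
    {d : ℕ} (hd : Module.finrank ℝ E = d + 1) :
    ∃ C : ENNReal, C ≠ ⊤ ∧ ∀ (x₀ : E) (r : ℝ), 0 < r → ∃ g : E → ℝ, ContDiff ℝ 1 g ∧
      (∀ x, 0 ≤ g x ∧ g x ≤ 1) ∧ (∀ x ∈ Metric.ball x₀ r, g x = 0) ∧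
      (∀ x, 2 * r ≤ dist x x₀ → g x = 1) ∧
      ∫⁻ x, ‖fderiv ℝ g x‖ₑ ≤ C * ENNReal.ofReal (r ^ d) := by
  let b : ContDiffBump (0 : E) := ⟨1, 2, one_pos, one_lt_two⟩
  have hb1 : ContDiff ℝ 1 b := b.contDiff
  obtain ⟨M, hM⟩ := (b.hasCompactSupport.fderiv (𝕜 := ℝ)).exists_bound_of_continuous
    (hb1.continuous_fderiv one_ne_zero)
  have hM0 : 0 ≤ M := (norm_nonneg _).trans (hM 0)
  refine ⟨ENNReal.ofReal (M * 2 ^ (d + 1)) * volume (Metric.ball (0 : E) 1),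
    ENNReal.mul_ne_top ENNReal.ofReal_ne_top measure_ball_lt_top.ne, fun x₀ r hr => ?_⟩
  set g : E → ℝ := fun x => 1 - b (r⁻¹ • (x - x₀)) with hg
  have hg1 : ContDiff ℝ 1 g :=
    contDiff_const.sub (hb1.comp (contDiff_const.smul (contDiff_id.sub contDiff_const)))
  have hnorm : ∀ x, ‖r⁻¹ • (x - x₀)‖ = dist x x₀ / r := fun x => by
    rw [norm_smul, norm_inv, Real.norm_of_nonneg hr.le, dist_eq_norm, div_eq_inv_mul]
  have hone : ∀ x, 2 * r ≤ dist x x₀ → g x = 1 := by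
    intro x hx
    have : b (r⁻¹ • (x - x₀)) = 0 := by
      refine b.zero_of_le_dist ?_
      rw [dist_zero_right, hnorm, le_div_iff₀ hr]
      exact hx
    simp [hg, this]
  have hfd : ∀ x, ‖fderiv ℝ g x‖ ≤ M * r⁻¹ := by
    intro x
    have h1 : HasFDerivAt (fun x => r⁻¹ • (x - x₀)) (r⁻¹ • ContinuousLinearMap.id ℝ E) x :=
      ((hasFDerivAt_id x).sub_const x₀).const_smul r⁻¹
    have h2 := (((hb1.differentiable one_ne_zero _).hasFDerivAt).comp x h1).const_sub 1
    have h3 : fderiv ℝ g x = _ := h2.fderiv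
    rw [h3, norm_neg]
    refine (ContinuousLinearMap.opNorm_comp_le _ _).trans ?_
    refine mul_le_mul (hM _) ?_ (norm_nonneg _) hM0
    rw [norm_smul, norm_inv, Real.norm_of_nonneg hr.le]
    exact mul_le_of_le_one_right (by positivity) ContinuousLinearMap.norm_id_le
  have hfd0 : ∀ x, x ∉ Metric.closedBall x₀ (2 * r) → fderiv ℝ g x = 0 := by
    intro x hx
    have : g =ᶠ[𝓝 x] fun _ => 1 := by
      filter_upwards [Metric.isClosed_closedBall.isOpen_compl.mem_nhds hx] with y hy
      rw [mem_compl_iff, Metric.mem_closedBall, not_le] at hy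
      exact hone y hy.le
    simp [this.fderiv_eq]
  refine ⟨g, hg1, fun x => ⟨?_, ?_⟩, fun x hx => ?_, hone, ?_⟩
  · simpa [hg] using b.le_one
  · simpa [hg] using b.nonneg
  · have : b (r⁻¹ • (x - x₀)) = 1 := by
      refine b.one_of_mem_closedBall ?_
      rw [mem_closedBall_zero_iff, hnorm, div_le_iff₀ hr, one_mul]
      exact (Metric.mem_ball.1 hx).le
    simp [hg, this]
  · calc ∫⁻ x, ‖fderiv ℝ g x‖ₑ
        ≤ ∫⁻ x, (Metric.closedBall x₀ (2 * r)).indicator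
            (fun _ => ENNReal.ofReal (M * r⁻¹)) x := by
          refine lintegral_mono fun x => ?_
          by_cases hx : x ∈ Metric.closedBall x₀ (2 * r)
          · rw [indicator_of_mem hx, ← ofReal_norm]
            exact ENNReal.ofReal_le_ofReal (hfd x)
          · rw [← ofReal_norm, hfd0 x hx, norm_zero, ENNReal.ofReal_zero]
            exact zero_le
      _ = ENNReal.ofReal (M * r⁻¹) * (ENNReal.ofReal ((2 * r) ^ (d + 1)) *
            volume (Metric.ball (0 : E) 1)) := by
          rw [lintegral_indicator_const Metric.isClosed_closedBall.measurableSet,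
            Measure.addHaar_closedBall _ _ (by positivity), hd]
      _ = _ := by
          rw [← mul_assoc, ← ENNReal.ofReal_mul (by positivity),
            mul_right_comm (ENNReal.ofReal (M * 2 ^ (d + 1))), ← ENNReal.ofReal_mul (by positivity)]
          congr 2
          rw [mul_pow, pow_succ r]
          field_simp

/-- A near-optimal cover by sets of small diameter is replaced by balls centred on S with radii
slightly above the diameters. The enlargement costs a summable error, and compactness leaves
finitely many balls. -/
theorem exists_ball_cover_of_hausdorffMeasure_eq_zero {X : Type*} [MetricSpace X] [Nonempty X]
    [MeasurableSpace X] [BorelSpace X] {S : Set X} (hS : IsCompact S) {d : ℕ}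
    (h0 : Measure.hausdorffMeasure (d : ℝ) S = 0) {ε : ENNReal} (hε : ε ≠ 0) {ρ : ℝ}
    (hρ : 0 < ρ) :
    ∃ (t : Finset ℕ) (x : ℕ → X) (r : ℕ → ℝ), (S ⊆ ⋃ i ∈ t, Metric.ball (x i) (r i)) ∧
      (∀ i ∈ t, x i ∈ S ∧ 0 < r i ∧ r i < ρ) ∧ ∑ i ∈ t, ENNReal.ofReal (r i ^ d) ≤ ε := by
  rw [Measure.hausdorffMeasure_apply] at h0
  have hε2 : ε / 2 ≠ 0 := (ENNReal.half_pos hε).ne'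
  have hρ2 : 0 < ENNReal.ofReal (ρ / 2) := ENNReal.ofReal_pos.2 (half_pos hρ)
  have h1 := (iSup₂_le_iff.1 h0.le) (ENNReal.ofReal (ρ / 2)) hρ2
  have h2 := h1.trans_lt (pos_iff_ne_zero.2 hε2)
  obtain ⟨T, h3⟩ := iInf_lt_iff.1 h2
  obtain ⟨hT, h4⟩ := iInf_lt_iff.1 h3
  obtain ⟨hTd, h5⟩ := iInf_lt_iff.1 h4
  obtain ⟨ε', hε'0, hε'⟩ := ENNReal.exists_pos_sum_of_countable hε2 ℕ
  have hch : ∀ n, ∃ p : X × ℝ, (T n ∩ S).Nonempty → p.1 ∈ T n ∩ S ∧ 0 < p.2 ∧ p.2 < ρ ∧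
      Metric.ediam (T n) < ENNReal.ofReal p.2 ∧
      ENNReal.ofReal (p.2 ^ d) ≤ Metric.ediam (T n) ^ (d : ℝ) + ε' n := by
    intro n
    by_cases hne : (T n ∩ S).Nonempty
    · obtain ⟨y, hy⟩ := hne
      set D := (Metric.ediam (T n)).toReal with hD
      have hfin : Metric.ediam (T n) ≠ ⊤ := ((hTd n).trans_lt ENNReal.ofReal_lt_top).ne
      have hD0 : 0 ≤ D := ENNReal.toReal_nonneg
      have hDe : Metric.ediam (T n) = ENNReal.ofReal D := (ENNReal.ofReal_toReal hfin).symm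
      have hDρ : D < ρ := by
        have : D ≤ ρ / 2 := ENNReal.toReal_le_of_le_ofReal (by positivity) (hTd n)
        linarith
      have hc : ContinuousAt (fun s : ℝ => s ^ d) D := (continuous_pow d).continuousAt
      have hev : ∀ᶠ s in 𝓝[>] D, s < ρ ∧ s ^ d < D ^ d + ε' n ∧ D < s := by
        have h6 : ∀ᶠ s in 𝓝 D, s < ρ ∧ s ^ d < D ^ d + ε' n :=
          (gt_mem_nhds hDρ).and (hc.eventually (gt_mem_nhds (by
            have : (0 : ℝ) < ε' n := by exact_mod_cast hε'0 n
            linarith)))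
        filter_upwards [h6.filter_mono nhdsWithin_le_nhds, self_mem_nhdsWithin] with s h7 h8
        exact ⟨h7.1, h7.2, h8⟩
      obtain ⟨s, hs1, hs2, hs3⟩ := hev.exists
      refine ⟨(y, s), fun _ => ⟨hy, hD0.trans_lt hs3, hs1, ?_, ?_⟩⟩
      · rw [hDe]
        exact (ENNReal.ofReal_lt_ofReal_iff (hD0.trans_lt hs3)).2 hs3
      · rw [ENNReal.rpow_natCast, hDe, ← ENNReal.ofReal_pow hD0, ← ENNReal.ofReal_coe_nnreal,
          ← ENNReal.ofReal_add (by positivity) (by positivity)]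
        exact ENNReal.ofReal_le_ofReal hs2.le
    · exact ⟨(Classical.arbitrary X, 1), fun h => absurd h hne⟩
  choose p hp using hch
  -- The second condition empties U n when T n misses S, since the choice of p n is then arbitrary.
  let U : ℕ → Set X := fun n => {y | y ∈ Metric.ball (p n).1 (p n).2 ∧ (T n ∩ S).Nonempty}
  have hUo : ∀ n, IsOpen (U n) := fun n => Metric.isOpen_ball.inter isOpen_const
  have hSU : S ⊆ ⋃ n, U n := by
    intro y hy
    obtain ⟨n, hn⟩ := mem_iUnion.1 (hT hy)
    have hne : (T n ∩ S).Nonempty := ⟨y, hn, hy⟩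
    obtain ⟨h6, h7, -, h8, -⟩ := hp n hne
    refine mem_iUnion.2 ⟨n, ?_, hne⟩
    have h9 := (Metric.edist_le_ediam_of_mem hn h6.1).trans_lt h8
    rw [edist_dist] at h9
    exact (ENNReal.ofReal_lt_ofReal_iff h7).1 h9
  obtain ⟨t, ht⟩ := hS.elim_finite_subcover U hUo hSU
  classical
  refine ⟨t.filter fun n => (T n ∩ S).Nonempty, fun n => (p n).1, fun n => (p n).2, ?_, ?_, ?_⟩
  · intro y hy
    obtain ⟨n, hn, hyn⟩ := mem_iUnion₂.1 (ht hy)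
    exact mem_iUnion₂.2 ⟨n, Finset.mem_filter.2 ⟨hn, hyn.2⟩, hyn.1⟩
  · intro n hn
    obtain ⟨h6, h7, h8, -⟩ := hp n (Finset.mem_filter.1 hn).2
    exact ⟨h6.2, h7, h8⟩
  · calc ∑ n ∈ t.filter fun n => (T n ∩ S).Nonempty, ENNReal.ofReal ((p n).2 ^ d)
        ≤ ∑ n ∈ t.filter fun n => (T n ∩ S).Nonempty,
            ((⨆ _ : (T n).Nonempty, Metric.ediam (T n) ^ (d : ℝ)) + ε' n) := by
          refine Finset.sum_le_sum fun n hn => ?_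
          have hne := (Finset.mem_filter.1 hn).2
          obtain ⟨-, -, -, -, h6⟩ := hp n hne
          rwa [iSup_pos hne.left]
      _ ≤ (∑' n, ⨆ _ : (T n).Nonempty, Metric.ediam (T n) ^ (d : ℝ)) + ∑' n, (ε' n : ENNReal) := by
          rw [Finset.sum_add_distrib]
          exact add_le_add (ENNReal.sum_le_tsum _) (ENNReal.sum_le_tsum _)
      _ ≤ ε / 2 + ε / 2 := add_le_add h5.le hε'.le
      _ = ε := ENNReal.add_halves ε

/-- A compact set of zero `(N-1)`-dimensional measure can be cut off at small cost. -/
theorem exists_cutoff_of_hausdorffMeasure_eq_zero {E : Type*} [NormedAddCommGroup E]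
    [InnerProductSpace ℝ E] [FiniteDimensional ℝ E] [MeasurableSpace E] [BorelSpace E]
    {d : ℕ} (hd : Module.finrank ℝ E = d + 1) {S : Set E} (hS : IsCompact S)
    (h0 : Measure.hausdorffMeasure (d : ℝ) S = 0) {ε : ENNReal} (hε : ε ≠ 0) {ρ : ℝ}
    (hρ : 0 < ρ) :
    ∃ η : E → ℝ, ContDiff ℝ 1 η ∧ (∀ x, 0 ≤ η x ∧ η x ≤ 1) ∧ Disjoint (tsupport η) S ∧
      (∀ x, (∀ y ∈ S, ρ ≤ dist x y) → η x = 1) ∧ ∫⁻ x, ‖fderiv ℝ η x‖ₑ ≤ ε := by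
  obtain ⟨C, hC, hg⟩ := exists_cutoff_ball E hd
  have hε' : ε / (C + 1) ≠ 0 :=
    ENNReal.div_ne_zero.2 ⟨hε, ENNReal.add_ne_top.2 ⟨hC, ENNReal.one_ne_top⟩⟩
  obtain ⟨t, c, r, hcov, hcr, hsum⟩ :=
    exists_ball_cover_of_hausdorffMeasure_eq_zero hS h0 hε' (half_pos hρ)
  -- The cutoff is the product of the ball cutoffs; all factors lie in [0, 1], so the gradient
  -- integrals simply add.
  have hprod : ∀ s : Finset ℕ, s ⊆ t → ∃ η : E → ℝ, ContDiff ℝ 1 η ∧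
      (∀ x, 0 ≤ η x ∧ η x ≤ 1) ∧ (∀ i ∈ s, ∀ x ∈ Metric.ball (c i) (r i), η x = 0) ∧
      (∀ x, (∀ y ∈ S, ρ ≤ dist x y) → η x = 1) ∧
      ∫⁻ x, ‖fderiv ℝ η x‖ₑ ≤ C * ∑ i ∈ s, ENNReal.ofReal (r i ^ d) := by
    intro s
    induction s using Finset.induction_on with
    | empty =>
      intro _
      exact ⟨fun _ => 1, contDiff_const, by simp, by simp, by simp, by
        simp [← ofReal_norm]⟩
    | insert a s ha ih =>
      intro hst
      obtain ⟨η, h1, h2, h3, h4, h5⟩ := ih ((Finset.subset_insert a s).trans hst)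
      obtain ⟨hca, hra, hraρ⟩ := hcr a (hst (Finset.mem_insert_self a s))
      obtain ⟨g, g1, g2, g3, g4, g5⟩ := hg (c a) (r a) hra
      refine ⟨fun x => η x * g x, h1.mul g1, fun x => ⟨mul_nonneg (h2 x).1 (g2 x).1,
        mul_le_one₀ (h2 x).2 (g2 x).1 (g2 x).2⟩, fun i hi x hx => ?_, fun x hx => ?_, ?_⟩
      · rcases Finset.mem_insert.1 hi with rfl | hi
        · simp [g3 x hx]
        · simp [h3 i hi x hx]
      · simp [h4 x hx, g4 x (by linarith [hx _ hca])]
      · have hpt : ∀ x, ‖fderiv ℝ (fun x => η x * g x) x‖ₑ ≤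
            ‖fderiv ℝ g x‖ₑ + ‖fderiv ℝ η x‖ₑ := by
          intro x
          rw [fderiv_fun_mul (h1.differentiable one_ne_zero x) (g1.differentiable one_ne_zero x)]
          rw [← ofReal_norm, ← ofReal_norm, ← ofReal_norm,
            ← ENNReal.ofReal_add (norm_nonneg _) (norm_nonneg _)]
          refine ENNReal.ofReal_le_ofReal ((norm_add_le _ _).trans (add_le_add ?_ ?_))
          · rw [norm_smul, Real.norm_of_nonneg (h2 x).1]
            exact mul_le_of_le_one_left (norm_nonneg _) (h2 x).2
          · rw [norm_smul, Real.norm_of_nonneg (g2 x).1]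
            exact mul_le_of_le_one_left (norm_nonneg _) (g2 x).2
        have hm : Measurable fun x => ‖fderiv ℝ g x‖ₑ :=
          (g1.continuous_fderiv one_ne_zero).measurable.enorm
        rw [Finset.sum_insert ha, mul_add]
        calc _ ≤ ∫⁻ x, (‖fderiv ℝ g x‖ₑ + ‖fderiv ℝ η x‖ₑ) := lintegral_mono hpt
          _ = (∫⁻ x, ‖fderiv ℝ g x‖ₑ) + ∫⁻ x, ‖fderiv ℝ η x‖ₑ := lintegral_add_left hm _
          _ ≤ _ := add_le_add g5 h5
  obtain ⟨η, h1, h2, h3, h4, h5⟩ := hprod t subset_rfl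
  refine ⟨η, h1, h2, ?_, h4, ?_⟩
  · rw [Set.disjoint_left]
    intro x hx hxS
    obtain ⟨i, hi, hxi⟩ := mem_iUnion₂.1 (hcov hxS)
    refine notMem_tsupport_iff_eventuallyEq.2 ?_ hx
    filter_upwards [Metric.isOpen_ball.mem_nhds hxi] with y hy
    exact h3 i hi y hy
  · calc _ ≤ _ := h5
      _ ≤ (C + 1) * (ε / (C + 1)) := mul_le_mul' le_self_add hsum
      _ ≤ ε := ENNReal.mul_div_le

/-! ### From local flux inequalities to the whole domain -/

/-- The local inequalities at the regular boundary points add up. -/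
theorem fluxPairing_nonpos {Ω : Set (EuclideanSpace ℝ ι)}
    {F : EuclideanSpace ℝ ι → EuclideanSpace ℝ ι} (hΩ : IsOpen Ω) (hb : Bornology.IsBounded Ω)
    (hF : HasBoundedDivergence Ω F)
    (hsign : ∀ x U φ, IsLocalDefiningFunction Ω x U φ →
      ∀ y ∈ frontier Ω ∩ U, fderiv ℝ φ y (F y) ≤ 0)
    {ζ : EuclideanSpace ℝ ι → ℝ} (hζ : ContDiff ℝ 1 ζ) (hζ0 : ∀ x, 0 ≤ ζ x)
    (hζs : Disjoint (tsupport ζ) (frontier Ω \ regularBoundary Ω)) : fluxPairing Ω F ζ ≤ 0 := by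
  have hloc : ∀ x : ↥(closure Ω ∩ tsupport ζ), ∃ W : Set (EuclideanSpace ℝ ι), IsOpen W ∧
      ↑x ∈ W ∧ ∀ g : EuclideanSpace ℝ ι → ℝ, ContDiff ℝ 1 g → (∀ x, 0 ≤ g x) →
      tsupport g ⊆ W → fluxPairing Ω F g ≤ 0 := by
    rintro ⟨x, hxc, hxs⟩
    by_cases hx : x ∈ Ω
    · refine ⟨Ω, hΩ, hx, fun g hg _ hgs => (fluxPairing_eq_zero hF hΩ hg ?_ hgs).le⟩
      exact Metric.isCompact_of_isClosed_isBounded (isClosed_tsupport g) (hb.subset hgs)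
    · have hxf : x ∈ frontier Ω := by rw [hΩ.frontier_eq]; exact ⟨hxc, hx⟩
      have hxr : x ∈ regularBoundary Ω := by
        by_contra hcon
        exact Set.disjoint_left.1 hζs hxs ⟨hxf, hcon⟩
      obtain ⟨v, U, φ, hφ, -⟩ := hxr
      obtain ⟨ρ, hρ, h⟩ := exists_nhds_fluxPairing_nonpos hΩ hb hF hφ (hsign x U φ hφ)
      exact ⟨Metric.ball x ρ, Metric.isOpen_ball, Metric.mem_ball_self hρ, h⟩
  choose W hWo hxW hW using hloc
  have hK : IsCompact (closure Ω ∩ tsupport ζ) :=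
    hb.isCompact_closure.inter_right (isClosed_tsupport ζ)
  obtain ⟨t, ht⟩ := hK.elim_finite_subcover W hWo
    fun x hx => mem_iUnion.2 ⟨⟨x, hx⟩, hxW ⟨x, hx⟩⟩
  obtain ⟨f, hf⟩ := SmoothPartitionOfUnity.exists_isSubordinate 𝓘(ℝ, EuclideanSpace ℝ ι)
    hK.isClosed (fun i : t => W i) (fun i => hWo i) (by
      intro x hx
      obtain ⟨i, hi, hxi⟩ := mem_iUnion₂.1 (ht hx)
      exact mem_iUnion.2 ⟨⟨i, hi⟩, hxi⟩)
  have hf1 : ∀ i, ContDiff ℝ 1 (f i) := fun i =>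
    ((f i).contMDiff.contDiff).of_le (by exact_mod_cast le_top)
  have hg1 : ∀ i, ContDiff ℝ 1 fun x => f i x * ζ x := fun i => (hf1 i).mul hζ
  have heq : ∀ x ∈ Ω, ζ x = ∑ i, f i x * ζ x := by
    intro x hx
    by_cases hxs : x ∈ tsupport ζ
    · have := f.sum_eq_one (x := x) ⟨subset_closure hx, hxs⟩
      rw [finsum_eq_sum_of_fintype] at this
      rw [← Finset.sum_mul, this, one_mul]
    · simp [image_eq_zero_of_notMem_tsupport hxs]
  have hsum : fluxPairing Ω F ζ = ∑ i, fluxPairing Ω F fun x => f i x * ζ x := by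
    simp only [fluxPairing]
    rw [← integral_finsetSum _ fun i _ => hF.integrableOn hΩ hb (hg1 i)]
    refine setIntegral_congr_fun hΩ.measurableSet fun x hx => ?_
    have h1 : ζ =ᶠ[𝓝 x] fun y => ∑ i, f i y * ζ y := by
      filter_upwards [hΩ.mem_nhds hx] with y hy using heq y hy
    have h2 : fderiv ℝ ζ x = ∑ i, fderiv ℝ (fun y => f i y * ζ y) x := by
      rw [h1.fderiv_eq, fderiv_fun_sum fun i _ => (hg1 i).differentiable one_ne_zero x]
    rw [Finset.sum_add_distrib, ← Finset.sum_mul, ← heq x hx, h2,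
      _root_.sum_apply]
  rw [hsum]
  refine Finset.sum_nonpos fun i _ => hW i _ (hg1 i) (fun x => mul_nonneg (f.nonneg i x) (hζ0 x)) ?_
  exact (tsupport_mul_subset_left (f := f i) (g := ζ)).trans (hf i)

/-- Regularity is an open condition in the boundary: one local defining function serves every
boundary point of its neighbourhood. -/
theorem isCompact_singularBoundary {Ω : Set (EuclideanSpace ℝ ι)} (hb : Bornology.IsBounded Ω) :
    IsCompact (frontier Ω \ regularBoundary Ω) := by
  have hfc : IsCompact (frontier Ω) :=
    hb.isCompact_closure.of_isClosed_subset isClosed_frontier frontier_subset_closure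
  let O := ⋃₀ {U | ∃ x φ, IsLocalDefiningFunction Ω x U φ}
  have hO : IsOpen O := isOpen_sUnion fun U ⟨x, φ, h⟩ => h.isOpen
  have heq : frontier Ω \ regularBoundary Ω = frontier Ω \ O := by
    ext y
    refine and_congr_right fun hy => not_congr ⟨?_, ?_⟩
    · rintro ⟨v, U, φ, h, -⟩
      exact ⟨U, ⟨y, φ, h⟩, h.mem⟩
    · rintro ⟨U, ⟨x, φ, h⟩, hyU⟩
      exact ⟨_, U, φ, ⟨hy, h.isOpen, hyU, h.contDiffOn, h.gradient_ne_zero, h.inter_eq,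
        h.frontier_inter_eq⟩, rfl⟩
  rw [heq]
  exact hfc.diff hO

/-- A field with nonnegative divergence which does not point outwards at almost every boundary
point is divergence-free. -/
theorem IsAdmissibleDomain.divergence_eq_zero [Nonempty ι] {Ω : Set (EuclideanSpace ℝ ι)}
    (hΩ : IsAdmissibleDomain Ω) {F : EuclideanSpace ℝ ι → EuclideanSpace ℝ ι}
    (hF : HasBoundedDivergence Ω F) (hdiv : ∀ x ∈ Ω, 0 ≤ divergence F x)
    (hae : ∀ᵐ x ∂surfaceMeasure Ω, x ∈ frontier Ω → ⟪F x, outerUnitNormal Ω x⟫ ≤ 0) :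
    ∀ x ∈ Ω, divergence F x = 0 := by
  have ho := hΩ.isOpen
  have hb := hΩ.isBounded
  have hsign : ∀ x U φ, IsLocalDefiningFunction Ω x U φ →
      ∀ y ∈ frontier Ω ∩ U, fderiv ℝ φ y (F y) ≤ 0 := fun x U φ hφ =>
    hφ.fderiv_nonpos_of_ae hF.continuousOn hae
  have hSc := isCompact_singularBoundary hb
  set S := frontier Ω \ regularBoundary Ω with hS
  have hS0 : Measure.hausdorffMeasure ((Fintype.card ι - 1 : ℕ) : ℝ) S = 0 := by
    have h := hΩ.singular_null
    rw [surfaceMeasure, Measure.restrict_apply hSc.isClosed.measurableSet,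
      inter_eq_left.2 sdiff_subset, euclideanHausdorffMeasure_eq_zero_iff] at h
    exact h
  have hfin : Module.finrank ℝ (EuclideanSpace ℝ ι) = (Fintype.card ι - 1) + 1 := by
    rw [finrank_euclideanSpace, Nat.sub_add_cancel Fintype.card_pos]
  obtain ⟨B, hB⟩ := hb.isCompact_closure.exists_bound_of_continuousOn hF.continuousOn
  intro x hx
  by_contra hne
  have hpos : 0 < divergence F x := lt_of_le_of_ne (hdiv x hx) (Ne.symm hne)
  set a := divergence F x / 2 with ha
  have ha0 : 0 < a := half_pos hpos
  have hcd := (hF.contDiffOn.continuousOn_divergence ho).continuousAt (ho.mem_nhds hx)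
  have hev : ∀ᶠ y in 𝓝 x, y ∈ Ω ∧ a < divergence F y :=
    (ho.eventually_mem hx).and (hcd.eventually (lt_mem_nhds (half_lt_self hpos)))
  obtain ⟨ρ, hρ, hball⟩ := Metric.eventually_nhds_iff_ball.1 hev
  set K := Metric.ball x (ρ / 2) with hK
  have hKΩ : K ⊆ Ω := fun y hy => (hball y (Metric.ball_subset_ball (by linarith) hy)).1
  have hKvol : 0 < volume.real K := by
    refine ENNReal.toReal_pos ?_ measure_ball_lt_top.ne
    exact (Metric.isOpen_ball.measure_pos _ ⟨x, Metric.mem_ball_self (half_pos hρ)⟩).ne'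
  -- The cutoff near the singular set equals 1 on K, because the boundary is at distance at least
  -- ρ/2 from K. So ∫ η div F ≥ a · vol K, while the error ∫ ∇η·F is at most |B| ε in absolute
  -- value.
  have key : ∀ ε : ℝ, 0 < ε → a * volume.real K ≤ |B| * ε := by
    intro ε hε
    obtain ⟨η, h1, h2, h3, h4, h5⟩ := exists_cutoff_of_hausdorffMeasure_eq_zero hfin hSc hS0
      (ENNReal.ofReal_pos.2 hε).ne' (half_pos hρ)
    have hle := fluxPairing_nonpos ho hb hF hsign h1 (fun x => (h2 x).1) h3
    have hcη : Continuous fun y => ‖fderiv ℝ η y‖ := (h1.continuous_fderiv one_ne_zero).norm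
    have hiη : IntegrableOn (fun y => ‖fderiv ℝ η y‖) Ω :=
      (hcη.continuousOn.integrableOn_compact hb.isCompact_closure).mono_set subset_closure
    have hηε : ∫ y in Ω, ‖fderiv ℝ η y‖ ≤ ε := by
      rw [integral_norm_eq_lintegral_enorm
        (h1.continuous_fderiv one_ne_zero).aestronglyMeasurable]
      refine ENNReal.toReal_le_of_le_ofReal hε.le ((setLIntegral_le_lintegral _ _).trans h5)
    have hiK : IntegrableOn (K.indicator fun _ => a) Ω :=
      (integrable_indicator_iff Metric.isOpen_ball.measurableSet).2
        (integrableOn_const (hs := ((Measure.restrict_apply_le _ _).trans_lt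
          measure_ball_lt_top).ne))
    have hpt : ∀ y ∈ Ω, K.indicator (fun _ => a) y - |B| * ‖fderiv ℝ η y‖ ≤
        η y * divergence F y + fderiv ℝ η y (F y) := by
      intro y hy
      have h6 : -(|B| * ‖fderiv ℝ η y‖) ≤ fderiv ℝ η y (F y) := by
        have h7 := (fderiv ℝ η y).le_opNorm (F y)
        have h8 : ‖F y‖ ≤ |B| := (hB y (subset_closure hy)).trans (le_abs_self B)
        have h9 : ‖fderiv ℝ η y‖ * ‖F y‖ ≤ |B| * ‖fderiv ℝ η y‖ := by
          rw [mul_comm]; gcongr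
        have := neg_le_of_abs_le (h7.trans h9)
        exact this
      have h7 : K.indicator (fun _ => a) y ≤ η y * divergence F y := by
        by_cases hyK : y ∈ K
        · rw [indicator_of_mem hyK, h4 y, one_mul]
          · exact (hball y (Metric.ball_subset_ball (by linarith) hyK)).2.le
          · intro z hz
            by_contra! hcon
            have hzb : z ∈ Metric.ball x ρ := by
              rw [Metric.mem_ball]
              rw [hK, Metric.mem_ball] at hyK
              calc dist z x ≤ dist z y + dist y x := dist_triangle _ _ _
                _ < ρ / 2 + ρ / 2 := add_lt_add (by rwa [dist_comm]) hyK
                _ = ρ := add_halves ρ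
            have hzf : z ∈ frontier Ω := hz.1
            rw [ho.frontier_eq] at hzf
            exact hzf.2 (hball z hzb).1
        · rw [indicator_of_notMem hyK]
          exact mul_nonneg (h2 y).1 (hdiv y hy)
      linarith
    have hmono := setIntegral_mono_on (hiK.sub (hiη.const_mul |B|)) (hF.integrableOn ho hb h1)
      ho.measurableSet hpt
    have hmono' := hmono.trans hle
    rw [Pi.sub_def, integral_sub hiK (hiη.const_mul |B|), integral_const_mul,
      integral_indicator Metric.isOpen_ball.measurableSet, setIntegral_const, Measure.real,
      Measure.restrict_apply Metric.isOpen_ball.measurableSet, inter_eq_left.2 hKΩ,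
      smul_eq_mul] at hmono'
    have h10 : |B| * ∫ y in Ω, ‖fderiv ℝ η y‖ ≤ |B| * ε := by gcongr
    have h11 : volume.real K * a - |B| * ∫ y in Ω, ‖fderiv ℝ η y‖ ≤ 0 := hmono'
    linarith
  have h1 := key (a * volume.real K / (2 * (|B| + 1))) (by positivity)
  have h2 : |B| * (a * volume.real K / (2 * (|B| + 1))) ≤ a * volume.real K / 2 := by
    rw [mul_div_assoc', div_le_div_iff₀ (by positivity) two_pos]
    nlinarith [mul_pos ha0 hKvol, abs_nonneg B]
  linarith [mul_pos ha0 hKvol]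

end Singular

/-! ### The Jacobian generators are smooth and divergence-free -/

section Carnot

variable {r : ℕ} {n : Fin r → ℕ}

/-- The dilation as a continuous linear map. -/
noncomputable def dilationCLM (n : Fin r → ℕ) (t : ℝ) : GradedSpace n →L[ℝ] GradedSpace n :=
  LinearMap.toContinuousLinearMap
    { toFun := dilation n t
      map_add' := fun x y => by
        ext i
        simp [dilation, mul_add]
      map_smul' := fun c x => by
        ext i
        simp [dilation, mul_left_comm] }

theorem dilationCLM_apply (t : ℝ) (x : GradedSpace n) (i : Σ k : Fin r, Fin (n k)) :
    dilationCLM n t x i = t ^ (i.1.val + 1) * x i := rfl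

theorem continuous_dilationCLM_left (x : GradedSpace n) :
    Continuous fun t => dilationCLM n t x := by
  refine (PiLp.continuous_toLp 2 _).comp (continuous_pi fun i => ?_)
  exact (continuous_id.pow _).mul continuous_const

theorem dilationCLM_basisFun (t : ℝ) (i : Σ k : Fin r, Fin (n k)) :
    dilationCLM n t (EuclideanSpace.basisFun _ ℝ i) =
      t ^ (i.1.val + 1) • EuclideanSpace.basisFun _ ℝ i := by
  ext k
  rw [dilationCLM_apply]
  by_cases h : k = i
  · subst h; simp
  · simp [h]

variable [NeZero r] [Group (GradedSpace n)] [HomogeneousCarnotGroup n]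

theorem dilationCLM_mul {t : ℝ} (ht : 0 < t) (x y : GradedSpace n) :
    dilationCLM n t (x * y) = dilationCLM n t x * dilationCLM n t y :=
  HomogeneousCarnotGroup.dilation_mul t ht x y

theorem dilationCLM_one {t : ℝ} (ht : 0 < t) :
    dilationCLM n t (1 : GradedSpace n) = 1 := by
  have h := dilationCLM_mul ht (1 : GradedSpace n) 1
  rw [mul_one] at h
  exact (left_eq_mul.1 h)

theorem contDiff_mul_gradedSpace :
    ContDiff ℝ ∞ fun p : GradedSpace n × GradedSpace n => p.1 * p.2 := by
  have h := contMDiff_mul 𝓘(ℝ, GradedSpace n) ∞ (G := GradedSpace n)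
  rw [← modelWithCornersSelf_prod, chartedSpaceSelf_prod] at h
  exact h.contDiff

theorem contDiff_jacobianField (j : Fin (n 0)) : ContDiff ℝ ∞ (jacobianField n j) := by
  have h : ContDiff ℝ ∞ fun x : GradedSpace n => fderiv ℝ (fun y => x * y) 1 :=
    ContDiff.fderiv (f := fun x y : GradedSpace n => x * y) (g := fun _ => 1) (m := ∞)
      contDiff_mul_gradedSpace contDiff_const (by simp)
  exact h.clm_apply contDiff_const

/-- Differentiate δ_t(x ∘ y) = δ_t x ∘ δ_t y in y at the identity; a first-layer vector has weight
1, whence the single factor t. -/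
theorem dilationCLM_jacobianField {t : ℝ} (ht : 0 < t) (j : Fin (n 0)) (x : GradedSpace n) :
    dilationCLM n t (jacobianField n j x) = t • jacobianField n j (dilationCLM n t x) := by
  have hd : ∀ x y : GradedSpace n, DifferentiableAt ℝ (fun y => x * y) y := fun x y =>
    (contDiff_mul_gradedSpace.comp (contDiff_const.prodMk contDiff_id)).differentiable
      (by simp) y
  have h1 : HasFDerivAt (fun y => dilationCLM n t (x * y))
      ((dilationCLM n t).comp (fderiv ℝ (fun y => x * y) 1)) 1 :=
    (dilationCLM n t).hasFDerivAt.comp _ (hd x 1).hasFDerivAt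
  have h2 : HasFDerivAt (fun y => dilationCLM n t x * dilationCLM n t y)
      ((fderiv ℝ (fun y => dilationCLM n t x * y) 1).comp (dilationCLM n t)) 1 := by
    have h3 := (hd (dilationCLM n t x) (dilationCLM n t 1)).hasFDerivAt.comp (1 : GradedSpace n)
      (dilationCLM n t).hasFDerivAt
    rwa [dilationCLM_one ht] at h3
  simp only [dilationCLM_mul ht] at h1
  have h4 := congrArg (fun l : GradedSpace n →L[ℝ] GradedSpace n =>
    l (EuclideanSpace.single ⟨0, j⟩ 1)) (h1.unique h2)
  have h5 : dilationCLM n t (EuclideanSpace.single ⟨0, j⟩ 1) =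
      t • EuclideanSpace.single ⟨0, j⟩ 1 := by
    have := dilationCLM_basisFun (n := n) t ⟨0, j⟩
    simpa using this
  simp only [ContinuousLinearMap.comp_apply] at h4
  rw [h5, map_smul] at h4
  exact h4

/-- Each diagonal derivative ∂ᵢ(Xⱼ)ᵢ is homogeneous of degree -1 under dilations. Being continuous
at the origin, it vanishes, as letting t → 0 shows. -/
theorem divergence_jacobianField (j : Fin (n 0)) (x : GradedSpace n) :
    divergence (jacobianField n j) x = 0 := by
  set X := jacobianField n j with hX
  have hX1 : ContDiff ℝ 1 X := (contDiff_jacobianField j).of_le (by exact_mod_cast le_top)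
  refine Finset.sum_eq_zero fun i _ => ?_
  set e : GradedSpace n := EuclideanSpace.basisFun _ ℝ i with he
  have hc : Continuous fun y => (fderiv ℝ X y e) i :=
    (EuclideanSpace.proj (𝕜 := ℝ) i).continuous.comp
      ((hX1.continuous_fderiv one_ne_zero).clm_apply continuous_const)
  have hscale : ∀ t : ℝ, 0 < t →
      t * (fderiv ℝ X (dilationCLM n t x) e) i = (fderiv ℝ X x e) i := by
    intro t ht
    have h1 : HasFDerivAt (fun y => dilationCLM n t (X y))
        ((dilationCLM n t).comp (fderiv ℝ X x)) x :=
      (dilationCLM n t).hasFDerivAt.comp x (hX1.differentiable one_ne_zero x).hasFDerivAt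
    have h2 : HasFDerivAt (fun y => t • X (dilationCLM n t y))
        (t • (fderiv ℝ X (dilationCLM n t x)).comp (dilationCLM n t)) x :=
      (((hX1.differentiable one_ne_zero _).hasFDerivAt).comp x
        (dilationCLM n t).hasFDerivAt).const_smul t
    simp only [hX, dilationCLM_jacobianField ht] at h1
    have h3 := congrArg (fun l : GradedSpace n →L[ℝ] GradedSpace n => l e i) (h1.unique h2)
    simp only [ContinuousLinearMap.comp_apply, dilationCLM_apply, _root_.smul_apply,
      PiLp.smul_apply, smul_eq_mul, he, dilationCLM_basisFun, map_smul] at h3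
    have ht' : t ^ (i.1.val + 1) ≠ 0 := (pow_pos ht _).ne'
    rw [mul_left_comm] at h3
    exact (mul_left_cancel₀ ht' h3).symm
  have hlim : Tendsto (fun t : ℝ => t * (fderiv ℝ X (dilationCLM n t x) e) i) (𝓝[>] 0) (𝓝 0) := by
    have h1 : Continuous fun t : ℝ => t * (fderiv ℝ X (dilationCLM n t x) e) i :=
      continuous_id.mul (hc.comp (continuous_dilationCLM_left x))
    have h2 := h1.tendsto 0
    rw [zero_mul] at h2
    exact h2.mono_left nhdsWithin_le_nhds
  have hconst : Tendsto (fun t : ℝ => t * (fderiv ℝ X (dilationCLM n t x) e) i) (𝓝[>] 0)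
      (𝓝 ((fderiv ℝ X x e) i)) := by
    refine tendsto_const_nhds.congr' ?_
    filter_upwards [self_mem_nhdsWithin] with t ht
    exact (hscale t ht).symm
  exact tendsto_nhds_unique hconst hlim

end Carnot

/-! ### Horizontally constant functions -/

section Commutators

variable {E G : Type*} [NormedAddCommGroup E] [NormedSpace ℝ E] [NormedAddCommGroup G]
  [NormedSpace ℝ G]

theorem IsIteratedCommutator.contDiff {ι : Type*} {X : ι → E → E}
    (hX : ∀ j, ContDiff ℝ ∞ (X j)) {V : E → E} (hV : IsIteratedCommutator X V) :
    ContDiff ℝ ∞ V := by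
  induction hV with
  | generator j => exact hX j
  | bracket _ _ hV hW =>
    rw [VectorField.lieBracket_eq]
    exact ((hW.fderiv_right (by simp)).clm_apply hV).sub
      ((hV.fderiv_right (by simp)).clm_apply hW)

/-- A `C²` function annihilated by the generators is annihilated by all iterated commutators. -/
theorem IsIteratedCommutator.derivAlong_eq_zero {ι : Type*} {X : ι → E → E}
    (hX : ∀ j, ContDiff ℝ ∞ (X j)) {Ω : Set E} (hΩ : IsOpen Ω) {u : E → G}
    (hu : ContDiffOn ℝ 2 u Ω) (h0 : ∀ j, ∀ x ∈ Ω, derivAlong (X j) u x = 0) {V : E → E}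
    (hV : IsIteratedCommutator X V) : ∀ x ∈ Ω, derivAlong V u x = 0 := by
  induction hV with
  | generator j => exact h0 j
  | @bracket V W hV' hW' hV hW =>
    intro x hx
    have hux : ContDiffAt ℝ 2 u x := hu.contDiffAt (hΩ.mem_nhds hx)
    have hd : DifferentiableAt ℝ (fderiv ℝ u) x :=
      (hux.fderiv_right (m := 1) (by norm_num)).differentiableAt one_ne_zero
    have hsymm : IsSymmSndFDerivAt ℝ u x := hux.isSymmSndFDerivAt (by simp)
    -- Differentiating Yu = 0 in the direction v. Subtracting the instances (W, V x) and (V, W x)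
    -- cancels the second derivatives by symmetry and leaves [V, W]u = 0.
    have hder : ∀ {Y : E → E}, ContDiff ℝ ∞ Y → (∀ y ∈ Ω, derivAlong Y u y = 0) → ∀ v : E,
        fderiv ℝ (fderiv ℝ u) x v (Y x) + fderiv ℝ u x (fderiv ℝ Y x v) = 0 := by
      intro Y hY hYu v
      have h1 := hd.hasFDerivAt.clm_apply (hY.differentiable (by simp) x).hasFDerivAt
      have h2 : (fun y => fderiv ℝ u y (Y y)) =ᶠ[𝓝 x] fun _ => 0 := by
        filter_upwards [hΩ.mem_nhds hx] with y hy using hYu y hy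
      have h3 := h1.fderiv
      rw [h2.fderiv_eq, fderiv_fun_const] at h3
      have h4 := congrArg (fun l : E →L[ℝ] G => l v) h3
      simp at h4
      rw [add_comm]
      exact h4.symm
    have e1 := hder (hW'.contDiff hX) hW (V x)
    have e2 := hder (hV'.contDiff hX) hV (W x)
    rw [derivAlong, VectorField.lieBracket_eq, map_sub, ← sub_eq_zero.2 (e1.trans e2.symm),
      hsymm.eq (V x) (W x)]
    abel

end Commutators

/-! ### The energy method for the Robin and mixed problems -/

theorem contDiffOn_re_conj_mul {𝕜 E : Type*} [RCLike 𝕜] [NormedAddCommGroup E]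
    [NormedSpace ℝ E] {Ω : Set E} {u w : E → 𝕜} (hu : ContDiffOn ℝ 1 u Ω)
    (hw : ContDiffOn ℝ 1 w Ω) :
    ContDiffOn ℝ 1 (fun x => RCLike.re (starRingEnd 𝕜 (u x) * w x)) Ω :=
  (RCLike.reCLM (K := 𝕜)).contDiff.comp_contDiffOn
    (((RCLike.conjCLE (K := 𝕜)).contDiff.comp_contDiffOn hu).mul hw)

section Robin

variable {r : ℕ} [NeZero r] {n : Fin r → ℕ} [Group (GradedSpace n)]

/-- A `C²` function annihilated by the Jacobian generators is constant on connected open sets. -/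
theorem exists_eq_const_of_derivAlong_jacobianField [HomogeneousCarnotGroup n]
    {G : Type*} [NormedAddCommGroup G] [NormedSpace ℝ G]
    {Ω : Set (GradedSpace n)} (hΩ : IsOpen Ω) (hc : IsPreconnected Ω) {u : GradedSpace n → G}
    (hu : ContDiffOn ℝ 2 u Ω) (h0 : ∀ j, ∀ x ∈ Ω, derivAlong (jacobianField n j) u x = 0) :
    ∃ c, ∀ x ∈ Ω, u x = c := by
  refine hΩ.exists_is_const_of_fderiv_eq_zero (𝕜 := ℝ) hc (hu.differentiableOn two_ne_zero)
    fun x hx => ?_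
  have hle : Submodule.span ℝ
      {v | ∃ V, IsIteratedCommutator (jacobianField n) V ∧ V x = v} ≤
      LinearMap.ker (fderiv ℝ u x : GradedSpace n →ₗ[ℝ] G) := by
    refine Submodule.span_le.2 ?_
    rintro _ ⟨V, hV, rfl⟩
    exact hV.derivAlong_eq_zero contDiff_jacobianField hΩ hu h0 x hx
  rw [HomogeneousCarnotGroup.rank_condition x] at hle
  ext v
  exact hle (Submodule.mem_top (x := v))

variable {𝕜 : Type*} [RCLike 𝕜] {Ω : Set (GradedSpace n)} {u : GradedSpace n → 𝕜}

theorem IsC2InteriorC1Closure.continuousOn_closureDerivAlong {E F : Type*}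
    [NormedAddCommGroup E] [NormedSpace ℝ E] [NormedAddCommGroup F] [NormedSpace ℝ F] {Ω : Set E}
    {u : E → F} (hu : IsC2InteriorC1Closure Ω u) {X : E → E} (hX : Continuous X) :
    ContinuousOn (closureDerivAlong Ω X u) (closure Ω) :=
  (continuousOn_extendFrom subset_rfl hu.tendsto_fderiv).clm_apply hX.continuousOn

theorem closureDerivAlong_eq {E F : Type*}
    [NormedAddCommGroup E] [NormedSpace ℝ E] [NormedAddCommGroup F] [NormedSpace ℝ F] {Ω : Set E}
    {u : E → F} (hΩ : IsOpen Ω) (hu : ContDiffOn ℝ 2 u Ω) (X : E → E) {x : E} (hx : x ∈ Ω) :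
    closureDerivAlong Ω X u x = derivAlong X u x := by
  rw [closureDerivAlong, derivAlong, extendFrom_eq (subset_closure hx)
    (hu.continuousOn_fderiv_of_isOpen hΩ one_le_two x hx)]

theorem closureDerivAlong_eq_zero {E F : Type*}
    [NormedAddCommGroup E] [NormedSpace ℝ E] [NormedAddCommGroup F] [NormedSpace ℝ F] {Ω : Set E}
    {u : E → F} (hΩ : IsOpen Ω) {c : F} (hu : ∀ x ∈ Ω, u x = c) (X : E → E) {x : E}
    (hx : x ∈ closure Ω) : closureDerivAlong Ω X u x = 0 := by
  have h : Tendsto (fderiv ℝ u) (𝓝[Ω] x) (𝓝 0) := by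
    refine tendsto_const_nhds.congr' ?_
    filter_upwards [self_mem_nhdsWithin] with y hy
    have : u =ᶠ[𝓝 y] fun _ => c := by
      filter_upwards [hΩ.mem_nhds hy] with z hz using hu z hz
    simp [this.fderiv_eq]
  rw [closureDerivAlong, extendFrom_eq hx h, _root_.zero_apply]

theorem boundaryDensity_mul_const (a : Fin (n 0) → GradedSpace n → ℝ) (z : 𝕜)
    (x : GradedSpace n) :
    boundaryDensity n Ω (fun j y => (a j y : 𝕜) * z) x =
      ((boundaryDensity n Ω a x : ℝ) : 𝕜) * z := by
  have hs : ∀ (c : ℝ) (w : 𝕜), c • w = (c : 𝕜) * w := fun c w => RCLike.real_smul_eq_coe_mul c w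
  simp only [boundaryDensity, smul_eq_mul]
  push_cast
  rw [Finset.sum_mul]
  refine Finset.sum_congr rfl fun j _ => ?_
  rw [hs, mul_assoc]

/-- Only values on the closure matter: interior derivatives are local, and boundary derivatives are
limits from inside. -/
theorem isDirichletRobinSolution_of_eq_zero (hΩ : IsOpen Ω) (a : Fin (n 0) → GradedSpace n → ℝ)
    {Γ : Set (GradedSpace n)} (hΓ : Γ ⊆ frontier Ω) (hu : ∀ x ∈ closure Ω, u x = 0) :
    IsDirichletRobinSolution n Ω a Γ u := by
  have hloc : ∀ x ∈ Ω, u =ᶠ[𝓝 x] fun _ => 0 := fun x hx => by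
    filter_upwards [hΩ.mem_nhds hx] with y hy using hu y (subset_closure hy)
  have hD : ∀ x ∈ Ω, fderiv ℝ u x = 0 := fun x hx => by simp [(hloc x hx).fderiv_eq]
  refine ⟨⟨?_, ?_, fun x _ => ⟨0, ?_⟩⟩, fun x hx => ?_, fun x hx =>
    hu x (frontier_subset_closure (hΓ hx)), Eventually.of_forall fun x hx => ?_⟩
  · exact contDiffOn_const.congr fun x hx => hu x (subset_closure hx)
  · exact continuousOn_const.congr hu
  · refine tendsto_const_nhds.congr' ?_
    filter_upwards [self_mem_nhdsWithin] with y hy using (hD y hy).symm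
  · refine Finset.sum_eq_zero fun k _ => ?_
    have h1 : derivAlong (jacobianField n k) u =ᶠ[𝓝 x] fun _ => 0 := by
      filter_upwards [hΩ.mem_nhds hx] with y hy
      rw [derivAlong, hD y hy, _root_.zero_apply]
    rw [derivAlong, h1.fderiv_eq]
    simp
  · have hxc := frontier_subset_closure hx.1
    refine Finset.sum_eq_zero fun k _ => ?_
    simp only [hu x hxc,
      closureDerivAlong_eq_zero hΩ (fun y hy => hu y (subset_closure hy)) _ hxc]
    simp

/-- Lets a single constancy argument serve both problems. -/
theorem isRobinSolution_iff {a : Fin (n 0) → GradedSpace n → ℝ} :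
    IsRobinSolution n Ω a u ↔ IsDirichletRobinSolution n Ω a ∅ u := by
  constructor
  · intro h
    exact ⟨h.regular, h.harmonic, fun x hx => hx.elim, by simpa using h.robin⟩
  · intro h
    exact ⟨h.regular, h.harmonic, by simpa using h.robin⟩

/-- The field `∑ⱼ Re(ū Xⱼu) Xⱼ`, whose divergence is `∑ⱼ |Xⱼu|²` for harmonic `u`. -/
noncomputable def energyField (Ω : Set (GradedSpace n)) (u : GradedSpace n → 𝕜) (x : GradedSpace n) :
    GradedSpace n :=
  ∑ j : Fin (n 0), RCLike.re (starRingEnd 𝕜 (u x) * closureDerivAlong Ω (jacobianField n j) u x) •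
    jacobianField n j x

theorem energyField_eqOn (hΩ : IsOpen Ω) (hu : ContDiffOn ℝ 2 u Ω) :
    EqOn (energyField Ω u) (fun x => ∑ j : Fin (n 0),
      RCLike.re (starRingEnd 𝕜 (u x) * derivAlong (jacobianField n j) u x) •
        jacobianField n j x) Ω := by
  intro x hx
  exact Finset.sum_congr rfl fun j _ => by rw [closureDerivAlong_eq hΩ hu _ hx]

variable [HomogeneousCarnotGroup n]

theorem contDiffOn_derivAlong_jacobianField (hΩ : IsOpen Ω) (hu : ContDiffOn ℝ 2 u Ω)
    (j : Fin (n 0)) : ContDiffOn ℝ 1 (derivAlong (jacobianField n j) u) Ω :=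
  (hu.fderiv_of_isOpen hΩ (by norm_num)).clm_apply
    ((contDiff_jacobianField j).of_le (by exact_mod_cast le_top)).contDiffOn

/-- As div Xⱼ = 0, the j-th term contributes Xⱼ Re(ū Xⱼu) = Re(ū Xⱼ²u) + |Xⱼu|², and the first
summands add up to Re(ū ℒu) = 0. -/
theorem divergence_energyField (hΩ : IsOpen Ω) (hu : ContDiffOn ℝ 2 u Ω) {x : GradedSpace n}
    (hx : x ∈ Ω) (h0 : subLaplacian n u x = 0) :
    divergence (energyField Ω u) x =
      ∑ j : Fin (n 0), ‖derivAlong (jacobianField n j) u x‖ ^ 2 := by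
  have hnhds := hΩ.mem_nhds hx
  have hu1 : ContDiffOn ℝ 1 u Ω := hu.of_le one_le_two
  have hw := fun j => contDiffOn_derivAlong_jacobianField hΩ hu j
  have heq : energyField Ω u =ᶠ[𝓝 x] fun x => ∑ j : Fin (n 0),
      RCLike.re (starRingEnd 𝕜 (u x) * derivAlong (jacobianField n j) u x) •
        jacobianField n j x := by
    filter_upwards [hnhds] with y hy using energyField_eqOn hΩ hu hy
  have hX : ∀ j, DifferentiableAt ℝ (jacobianField n j) x := fun j =>
    (contDiff_jacobianField j).differentiable (by simp) x
  have hg : ∀ j, DifferentiableAt ℝ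
      (fun x => RCLike.re (starRingEnd 𝕜 (u x) * derivAlong (jacobianField n j) u x)) x :=
    fun j => ((contDiffOn_re_conj_mul hu1 (hw j)).contDiffAt hnhds).differentiableAt one_ne_zero
  have hdiv : divergence (energyField Ω u) x = divergence (fun x => ∑ j : Fin (n 0),
      RCLike.re (starRingEnd 𝕜 (u x) * derivAlong (jacobianField n j) u x) •
        jacobianField n j x) x := by
    simp only [divergence, heq.fderiv_eq]
  have hgX : ∀ j, fderiv ℝ
      (fun x => RCLike.re (starRingEnd 𝕜 (u x) * derivAlong (jacobianField n j) u x)) x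
        (jacobianField n j x) =
      RCLike.re (starRingEnd 𝕜 (u x) *
        derivAlong (jacobianField n j) (derivAlong (jacobianField n j) u) x) +
      ‖derivAlong (jacobianField n j) u x‖ ^ 2 := by
    intro j
    have h1 := ((hu1.contDiffAt hnhds).differentiableAt one_ne_zero).hasFDerivAt
    have h2 := (((hw j).contDiffAt hnhds).differentiableAt one_ne_zero).hasFDerivAt
    have h3 : HasFDerivAt (fun x => starRingEnd 𝕜 (u x))
        (((RCLike.conjCLE (K := 𝕜)) : 𝕜 →L[ℝ] 𝕜).comp (fderiv ℝ u x)) x :=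
      ((RCLike.conjCLE (K := 𝕜)) : 𝕜 →L[ℝ] 𝕜).hasFDerivAt.comp x h1
    have h4 : HasFDerivAt
        (fun x => RCLike.re (starRingEnd 𝕜 (u x) * derivAlong (jacobianField n j) u x)) _ x :=
      (RCLike.reCLM (K := 𝕜)).hasFDerivAt.comp x (h3.mul h2)
    rw [h4.fderiv]
    have h5 : derivAlong (jacobianField n j) u x *
        starRingEnd 𝕜 (derivAlong (jacobianField n j) u x) =
        ((‖derivAlong (jacobianField n j) u x‖ ^ 2 : ℝ) : 𝕜) := by
      rw [RCLike.mul_conj]; push_cast; rfl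
    have h6 : RCLike.re (derivAlong (jacobianField n j) u x *
        starRingEnd 𝕜 (derivAlong (jacobianField n j) u x)) =
        ‖derivAlong (jacobianField n j) u x‖ ^ 2 := by
      rw [h5, RCLike.ofReal_re]
    rw [← h6, ← map_add]
    rfl
  rw [hdiv, divergence_sum _ fun j _ => (hg j).fun_smul (hX j)]
  have hterm : ∀ j ∈ Finset.univ, divergence (fun x =>
      RCLike.re (starRingEnd 𝕜 (u x) * derivAlong (jacobianField n j) u x) •
        jacobianField n j x) x =
      RCLike.re (starRingEnd 𝕜 (u x) *
        derivAlong (jacobianField n j) (derivAlong (jacobianField n j) u) x) +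
      ‖derivAlong (jacobianField n j) u x‖ ^ 2 := fun j _ => by
    rw [divergence_smul (hg j) (hX j), divergence_jacobianField, mul_zero, zero_add, hgX]
  rw [Finset.sum_congr rfl hterm, Finset.sum_add_distrib, ← map_sum, ← Finset.mul_sum]
  have h7 : ∑ j : Fin (n 0),
      derivAlong (jacobianField n j) (derivAlong (jacobianField n j) u) x = 0 := h0
  rw [h7, mul_zero, map_zero, zero_add]

/-- Second derivatives of u may blow up at the boundary, but harmonicity removes them from the
divergence; what remains, ∑ⱼ |Xⱼu|², extends continuously to the compact closure. -/
theorem hasBoundedDivergence_energyField (hΩ : IsOpen Ω) (hb : Bornology.IsBounded Ω)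
    (hu : IsC2InteriorC1Closure Ω u) (h0 : ∀ x ∈ Ω, subLaplacian n u x = 0) :
    HasBoundedDivergence Ω (energyField Ω u) := by
  have hcd := fun j => hu.continuousOn_closureDerivAlong (contDiff_jacobianField (n := n) j).continuous
  refine ⟨?_, ?_, ?_⟩
  · refine ContDiffOn.congr ?_ (energyField_eqOn hΩ hu.contDiffOn)
    refine ContDiffOn.sum fun j _ => ContDiffOn.fun_smul ?_ ?_
    · exact contDiffOn_re_conj_mul (hu.contDiffOn.of_le one_le_two)
        (contDiffOn_derivAlong_jacobianField hΩ hu.contDiffOn j)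
    · exact ((contDiff_jacobianField j).of_le (by exact_mod_cast le_top)).contDiffOn
  · refine continuousOn_finsetSum _ fun j _ => ContinuousOn.fun_smul ?_ ?_
    · exact RCLike.continuous_re.comp_continuousOn
        ((RCLike.continuous_conj.comp_continuousOn hu.continuousOn).mul (hcd j))
    · exact (contDiff_jacobianField j).continuous.continuousOn
  · have hc : ContinuousOn (fun x => ∑ j : Fin (n 0),
        ‖closureDerivAlong Ω (jacobianField n j) u x‖ ^ 2) (closure Ω) :=
      continuousOn_finsetSum _ fun j _ => (hcd j).norm.pow 2
    obtain ⟨C, hC⟩ := hb.isCompact_closure.exists_bound_of_continuousOn hc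
    refine ⟨C, fun x hx => ?_⟩
    rw [divergence_energyField hΩ hu.contDiffOn hx (h0 x hx)]
    have h1 := hC x (subset_closure hx)
    simpa only [closureDerivAlong_eq hΩ hu.contDiffOn _ hx, Real.norm_eq_abs] using h1

/-- Solutions of the mixed problem are constant. -/
theorem IsDirichletRobinSolution.exists_eq_const [Nonempty (Σ k : Fin r, Fin (n k))]
    (hΩ : IsAdmissibleDomain Ω) {a : Fin (n 0) → GradedSpace n → ℝ}
    (ha : ∀ᵐ x ∂surfaceMeasure Ω, 0 ≤ boundaryDensity n Ω a x) {Γ : Set (GradedSpace n)}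
    (hu : IsDirichletRobinSolution n Ω a Γ u) : ∃ c, ∀ x ∈ closure Ω, u x = c := by
  have ho := hΩ.isOpen
  have hreg := hu.regular
  have hdiv := fun x hx => divergence_energyField ho hreg.contDiffOn hx (hu.harmonic x hx)
  have hae : ∀ᵐ x ∂surfaceMeasure Ω, x ∈ frontier Ω →
      ⟪energyField Ω u x, outerUnitNormal Ω x⟫ ≤ 0 := by
    filter_upwards [ha, hu.robin] with x hx hrob hxf
    have hE : ⟪energyField Ω u x, outerUnitNormal Ω x⟫ = RCLike.re (starRingEnd 𝕜 (u x) *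
        boundaryDensity n Ω (fun j => closureDerivAlong Ω (jacobianField n j) u) x) := by
      rw [energyField, sum_inner, boundaryDensity, Finset.mul_sum, map_sum]
      refine Finset.sum_congr rfl fun j _ => ?_
      rw [real_inner_smul_left, mul_smul_comm, RCLike.smul_re, mul_comm]
    rw [hE]
    by_cases hxΓ : x ∈ Γ
    · simp [hu.dirichlet x hxΓ]
    · have h1 := hrob ⟨hxf, hxΓ⟩
      -- The Robin condition, solved for the conormal derivative of u; multiplied by ū it gives
      -- minus the density of ∑ⱼ aⱼ⟨Xⱼ,dν⟩ times |u|².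
      have h2 : boundaryDensity n Ω (fun j => closureDerivAlong Ω (jacobianField n j) u) x =
          -(((boundaryDensity n Ω a x : ℝ) : 𝕜) * u x) := by
        rw [eq_neg_iff_add_eq_zero, ← h1, ← boundaryDensity_mul_const, add_comm]
        simp only [boundaryDensity, smul_add, Finset.sum_add_distrib]
      have h3 : starRingEnd 𝕜 (u x) * -(((boundaryDensity n Ω a x : ℝ) : 𝕜) * u x) =
          ((-(boundaryDensity n Ω a x * ‖u x‖ ^ 2) : ℝ) : 𝕜) := by
        push_cast
        rw [← RCLike.conj_mul]
        ring
      rw [h2, h3, RCLike.ofReal_re]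
      exact neg_nonpos.2 (mul_nonneg hx (sq_nonneg _))
  have hzero := hΩ.divergence_eq_zero
    (hasBoundedDivergence_energyField ho hΩ.isBounded hreg hu.harmonic)
    (fun x hx => by rw [hdiv x hx]; positivity) hae
  obtain ⟨c, hc⟩ := exists_eq_const_of_derivAlong_jacobianField ho hΩ.isConnected.isPreconnected
    hreg.contDiffOn (fun j x hx => by
      have h1 := hzero x hx
      rw [hdiv x hx, Finset.sum_eq_zero_iff_of_nonneg fun _ _ => by positivity] at h1
      simpa using h1 j (Finset.mem_univ j))
  exact ⟨c, Set.EqOn.of_subset_closure (s := Ω) (f := u) (g := fun _ => c) hc hreg.continuousOn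
    continuousOn_const subset_closure subset_rfl⟩

end Robin

theorem lemma2p6 {𝕜 : Type*} [RCLike 𝕜] {r : ℕ} [NeZero r] (n : Fin r → ℕ)
    [Group (GradedSpace n)] [HomogeneousCarnotGroup n] (hQ : 3 ≤ homogeneousDimension n)
    (Ω : Set (GradedSpace n)) (hΩ : IsAdmissibleDomain Ω)
    (a : Fin (n 0) → GradedSpace n → ℝ)
    (ha : ∀ j, ∃ C : ℝ, ∀ x ∈ frontier Ω, |a j x| ≤ C)
    (ha_nonneg : ∀ᵐ x ∂surfaceMeasure Ω, 0 ≤ boundaryDensity n Ω a x) :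
    -- The Robin problem has a constant solution, and only constant solutions.
    ((∃ c : 𝕜, IsRobinSolution n Ω a (fun _ => c)) ∧
      ∀ u : GradedSpace n → 𝕜, IsRobinSolution n Ω a u → ∃ c : 𝕜, ∀ x ∈ closure Ω, u x = c) ∧
    -- If the total mass is positive, the unique solution of the Robin problem is zero.
    ((0 < ∫ x, boundaryDensity n Ω a x ∂surfaceMeasure Ω) →
      ∀ u : GradedSpace n → 𝕜, IsRobinSolution n Ω a u ↔ ∀ x ∈ closure Ω, u x = 0) ∧
    -- The unique solution of the mixed problem is zero.
    (∀ Γ : Set (GradedSpace n), Γ ⊆ frontier Ω → Γ.Nonempty →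
      ∀ u : GradedSpace n → 𝕜,
        IsDirichletRobinSolution n Ω a Γ u ↔ ∀ x ∈ closure Ω, u x = 0) := by
  -- Q ≥ 3 enters through N ≥ 1, which makes N - 1 a genuine dimension in natural number
  -- subtraction.
  have hne : Nonempty (Σ k : Fin r, Fin (n k)) := by
    by_contra hcon
    have h0 : ∀ k, n k = 0 := fun k => by
      by_contra hk
      exact hcon ⟨⟨k, 0, Nat.pos_of_ne_zero hk⟩⟩
    simp [homogeneousDimension, h0] at hQ
  have hconst : ∀ u : GradedSpace n → 𝕜, IsRobinSolution n Ω a u →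
      ∃ c : 𝕜, ∀ x ∈ closure Ω, u x = c := fun u hu =>
    (isRobinSolution_iff.1 hu).exists_eq_const hΩ ha_nonneg
  have hzero : ∀ u : GradedSpace n → 𝕜, (∀ x ∈ closure Ω, u x = 0) →
      IsRobinSolution n Ω a u := fun u hu =>
    isRobinSolution_iff.2
      (isDirichletRobinSolution_of_eq_zero hΩ.isOpen a (empty_subset _) hu)
  refine ⟨⟨⟨0, hzero _ fun _ _ => rfl⟩, hconst⟩, fun hpos u => ⟨fun hu => ?_, hzero u⟩,
    fun Γ hΓ hΓne u => ⟨fun hu => ?_, isDirichletRobinSolution_of_eq_zero hΩ.isOpen a hΓ⟩⟩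
  · obtain ⟨c, hc⟩ := hconst u hu
    suffices c = 0 by simpa [this] using hc
    by_contra hc0
    have hfr : ∀ᵐ x ∂surfaceMeasure Ω, x ∈ frontier Ω :=
      ae_restrict_mem isClosed_frontier.measurableSet
    -- For a constant solution c ≠ 0 the Robin condition reads (∑ⱼ aⱼ⟨Xⱼ,v⟩) c = 0, so the total
    -- mass would vanish.
    have hae : boundaryDensity n Ω a =ᵐ[surfaceMeasure Ω] fun _ => 0 := by
      filter_upwards [hu.robin, hfr] with x hx hxf
      have h1 := hx hxf
      have hxc := frontier_subset_closure hxf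
      have h2 : boundaryDensity n Ω (fun j y => (a j y : 𝕜) * u y +
          closureDerivAlong Ω (jacobianField n j) u y) x =
          ((boundaryDensity n Ω a x : ℝ) : 𝕜) * c := by
        rw [← boundaryDensity_mul_const]
        simp only [boundaryDensity, hc x hxc, closureDerivAlong_eq_zero hΩ.isOpen
          (fun y hy => hc y (subset_closure hy)) _ hxc, add_zero]
      rw [h2, mul_eq_zero, or_iff_left hc0] at h1
      exact_mod_cast h1
    rw [integral_congr_ae hae, integral_zero] at hpos
    exact lt_irrefl _ hpos
  · obtain ⟨c, hc⟩ := hu.exists_eq_const hΩ ha_nonneg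
    obtain ⟨y, hy⟩ := hΓne
    have h1 := hc y (frontier_subset_closure (hΓ hy))
    rw [hu.dirichlet y hy] at h1
    simpa [← h1] using hc
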